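/- **Problem.** There are $n\ge 1$ agents. Agent $i$ has convex loss functions $f_{i,t}:\mathbb X\to\mathbb R$ and (componentwise) convex constraint functions $g_{i,t}:\mathbb X\to\mathbb R^{m_i}$, $t=1,2,\dots$. Here $\mathbb X\subseteq\mathbb R^p$ is closed and convex, contains a ball of positive radius centred at the origin, and is contained in the ball of radius $R$ centred at the origin. There are constants $F_1,F_2$ with $|f_{i,t}(x)-f_{i,t}(y)|\le F_1$ and $\|g_{i,t}(x)\|\le F_1$ for all $x,y\in\mathbb X$. At every $x\in\mathbb X$ a subgradient $\partial f_{i,t}(x)\in\mathbb R^p$ of $f_{i,t}$ and a matrix $\partial g_{i,t}(x)\in\mathbb R^{p\times m_i}$ whose columns are subgradients of the components of $g_{i,t}$ are given, with $\|\partial f_{i,t}(x)\|\le F_2$ and $\|\partial g_{i,t}(x)\|\le F_2$ (Euclidean and induced $2$-norm). $[\cdot]_+$ is the componentwise positive part, and $\partial[g_{i,t}(x)]_+$ is $\partial g_{i,t}(x)$ with the columns of those components of $g_{i,t}$ that are negative at $x$ replaced by $0$. Put $f_t=\frac1n\sum_j f_{j,t}$ and $g_t=(g_{1,t},\dots,g_{n,t})$.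 For every $T\ge1$ there is a point $x\in\mathbb X$ with $g_t(x)\le 0$ for all $1\le t\le T$. **Network.** $\mathcal G_t=([n],\mathcal E_t)$, $t\ge1$, are directed graphs, and $W_t\in\mathbb R^{n\times n}$ are doubly stochastic with $[W_t]_{ij}>0$ if $(j,i)\in\mathcal E_t$ or $i=j$, and $[W_t]_{ij}=0$ otherwise. There are $w\in(0,1)$ and an integer $B>0$ such that every positive entry of every $W_t$ is at least $w$, and $([n],\bigcup_{l=0}^{B-1}\mathcal E_{t+l})$ is strongly connected for every $t\ge 1$. **Algorithm.** Let $\alpha_0>0$, $\kappa\in(0,1)$, $\alpha_t=\alpha_0/t^{\kappa}$, $\beta_t=1/t^{\kappa}$, $\gamma_t=1/t^{1-\kappa}$. Start from any $x_{i,1}\in\mathbb X$ and $q_{i,1}=0$, and for $t\ge1$, $i\in[n]$ let $$z_{i,t+1}=\sum_{j}[W_t]_{ij}x_{j,t},\qquad \omega_{i,t+1}=\partial f_{i,t}(x_{i,t})+\partial[g_{i,t}(x_{i,t})]_+\,q_{i,t},$$ $$x_{i,t+1}=\mathcal P_{\mathbb X}(z_{i,t+1}-\alpha_{t+1}\omega_{i,t+1}),$$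 $$q_{i,t+1}=\big[(1-\beta_{t+1}\gamma_{t+1})q_{i,t}+\gamma_{t+1}\big([g_{i,t}(x_{i,t})]_++(\partial[g_{i,t}(x_{i,t})]_+)^\top(x_{i,t+1}-x_{i,t})\big)\big]_+,$$ where $\mathcal P_{\mathbb X}$ is the Euclidean projection onto $\mathbb X$. **Theorem.** There are a constant $C_1$, depending only on $n,(m_i)_i,\kappa,R,F_1,F_2,w,B$, and, for every $a>0$, a constant $C_2(a)$, depending only on the same quantities and $a$, such that the following holds for every such problem, network, $\alpha_0>0$ and run of the algorithm, and for every $T\ge 1$. (i) For every comparator sequence $y_1,\dots,y_T\in\mathbb X$ with $g_t(y_t)\le0$ for $1\le t\le T$, with path length $P_T=\sum_{t=1}^{T-1}\|y_{t+1}-y_t\|$, $$\frac1n\sum_{i=1}^n\sum_{t=1}^T f_t(x_{i,t})-\sum_{t=1}^T f_t(y_t)\le C_1\Big(\alpha_0T^{1-\kappa}+\frac{T^{\kappa}(1+P_T)}{\alpha_0}\Big).$$ (ii) If $\alpha_0\ge a$, then $$\frac1n\sum_{i=1}^n\sum_{t=1}^T\big\|[g_t(x_{i,t})]_+\big\|\le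 C_2(a)\sqrt{(\alpha_0+1)\,T^{2-\kappa}}.$$ -/

import Mathlib

/- Matrices carry the norm induced by the Euclidean vector norms. -/
open scoped Matrix.Norms.L2Operator

noncomputable section

/-- The space of `d`-dimensional real vectors with the Euclidean norm. -/
abbrev Vec (d : ℕ) : Type := EuclideanSpace ℝ (Fin d)

/-- Euclidean projection: `x` is a minimizer of `y ↦ ‖v - y‖ ^ 2` over `K`. -/
def IsProjection {d : ℕ} (K : Set (Vec d)) (v x : Vec d) : Prop :=
  x ∈ K ∧ IsMinOn (fun y => ‖v - y‖ ^ 2) K x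

/-- The clipping `[v]₊`, i.e. the projection onto the nonnegative orthant. -/
def clip {ι : Type} [Fintype ι] (v : EuclideanSpace ℝ ι) : EuclideanSpace ℝ ι :=
  WithLp.toLp 2 fun l => max (v l) 0

/-- The data of an online problem with `n` agents, decisions in `ℝ^p` and `m i` local constraints
at agent `i`: the decision set, the local losses `f i t`, the local constraint functions `g i t`,
and the first-order information the agents observe, namely a subgradient `df i t x` of `f i t` at
`x` and a matrix `dg i t x` whose `l`-th column is a subgradient of the `l`-th component of `g i t`
at `x`. Rounds are numbered `t = 1, 2, …`; nothing is used at `t = 0`. -/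
structure OnlineProblem (n p : ℕ) (m : Fin n → ℕ) where
  X : Set (Vec p)
  f : Fin n → ℕ → Vec p → ℝ
  g : (i : Fin n) → ℕ → Vec p → Vec (m i)
  df : Fin n → ℕ → Vec p → Vec p
  dg : (i : Fin n) → ℕ → Vec p → Matrix (Fin p) (Fin (m i)) ℝ

/-- `s` is a subgradient at `x` of the function `h` on the set `X`. -/
def IsSubgradientOn {d : ℕ} (X : Set (Vec d)) (h : Vec d → ℝ) (x s : Vec d) : Prop :=
  ∀ y ∈ X, h x + inner ℝ s (y - x) ≤ h y

namespace OnlineProblem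

variable {n p : ℕ} {m : Fin n → ℕ}

/-- The assumptions on the decision set, the losses and the constraint functions. -/
structure Regular (P : OnlineProblem n p m) (R F₁ F₂ : ℝ) : Prop where
  convex : Convex ℝ P.X
  closed : IsClosed P.X
  contains_ball : ∃ r : ℝ, 0 < r ∧ Metric.closedBall 0 r ⊆ P.X
  subset_ball : P.X ⊆ Metric.closedBall 0 R
  convex_f : ∀ i, ∀ t ≥ 1, ConvexOn ℝ P.X (P.f i t)
  convex_g : ∀ i, ∀ t ≥ 1, ∀ l, ConvexOn ℝ P.X fun x => P.g i t x l
  bound_f : ∀ i, ∀ t ≥ 1, ∀ x ∈ P.X, ∀ y ∈ P.X, |P.f i t x - P.f i t y| ≤ F₁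
  bound_g : ∀ i, ∀ t ≥ 1, ∀ x ∈ P.X, ‖P.g i t x‖ ≤ F₁
  subgradient_f : ∀ i, ∀ t ≥ 1, ∀ x ∈ P.X, IsSubgradientOn P.X (P.f i t) x (P.df i t x)
  subgradient_g : ∀ i, ∀ t ≥ 1, ∀ x ∈ P.X, ∀ l,
    IsSubgradientOn P.X (fun y => P.g i t y l) x (WithLp.toLp 2 ((P.dg i t x).col l))
  bound_df : ∀ i, ∀ t ≥ 1, ∀ x ∈ P.X, ‖P.df i t x‖ ≤ F₂
  bound_dg : ∀ i, ∀ t ≥ 1, ∀ x ∈ P.X, ‖P.dg i t x‖ ≤ F₂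

/-- `∂[g i t x]₊`: the `l`-th column is `0` if the `l`-th component of `g i t x` is negative, and
the `l`-th column of `dg i t x` otherwise. -/
def dgClip (P : OnlineProblem n p m) (i : Fin n) (t : ℕ) (x : Vec p) :
    Matrix (Fin p) (Fin (m i)) ℝ :=
  Matrix.of fun k l => if P.g i t x l < 0 then 0 else P.dg i t x k l

/-- The global loss `f_t`, the average of the local losses. -/
def globalLoss (P : OnlineProblem n p m) (t : ℕ) (x : Vec p) : ℝ :=
  (1 / (n : ℝ)) * ∑ j, P.f j t x

/-- The global constraint function `g_t`, the concatenation of the local ones. -/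
def globalConstraint (P : OnlineProblem n p m) (t : ℕ) (x : Vec p) :
    EuclideanSpace ℝ (Σ i : Fin n, Fin (m i)) :=
  WithLp.toLp 2 fun s => P.g s.1 t x s.2

/-- `x` is a decision that satisfies all the constraints of round `t`. -/
def Feasible (P : OnlineProblem n p m) (t : ℕ) (x : Vec p) : Prop :=
  x ∈ P.X ∧ ∀ s, P.globalConstraint t x s ≤ 0

/-- `(y 1, …, y T)` is a feasible decision sequence. -/
def FeasibleSeq (P : OnlineProblem n p m) (T : ℕ) (y : ℕ → Vec p) : Prop :=
  ∀ t ∈ Finset.Icc 1 T, P.Feasible t (y t)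

/-- For every horizon there is a feasible static decision sequence. -/
def StaticFeasible (P : OnlineProblem n p m) : Prop :=
  ∀ T ≥ 1, ∃ x : Vec p, P.FeasibleSeq T fun _ => x

/-- The network regret of the decisions `x t i` against the comparator `y`. -/
def netReg (P : OnlineProblem n p m) (T : ℕ) (x : ℕ → Fin n → Vec p) (y : ℕ → Vec p) : ℝ :=
  (1 / (n : ℝ)) * ∑ i, ∑ t ∈ Finset.Icc 1 T, P.globalLoss t (x t i)
    - ∑ t ∈ Finset.Icc 1 T, P.globalLoss t (y t)

/-- The network cumulative constraint violation of the decisions `x t i`. -/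
def netViolation (P : OnlineProblem n p m) (T : ℕ) (x : ℕ → Fin n → Vec p) : ℝ :=
  (1 / (n : ℝ)) * ∑ i, ∑ t ∈ Finset.Icc 1 T, ‖clip (P.globalConstraint t (x t i))‖

/-- `x t i` and `q t i` are the primal and dual iterates of the distributed online algorithm with
full-information feedback, run with mixing matrices `W t` and stepsizes `α t`, `β t`, `γ t`. -/
structure IsRun (P : OnlineProblem n p m) (W : ℕ → Matrix (Fin n) (Fin n) ℝ) (α β γ : ℕ → ℝ)
    (x : ℕ → Fin n → Vec p) (q : ℕ → (i : Fin n) → Vec (m i)) : Prop where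
  init_x : ∀ i, x 1 i ∈ P.X
  init_q : ∀ i, q 1 i = 0
  step_x : ∀ t ≥ 1, ∀ i,
    let z : Vec p := ∑ j, W t i j • x t j
    let ω : Vec p := P.df i t (x t i) + Matrix.toEuclideanLin (P.dgClip i t (x t i)) (q t i)
    IsProjection P.X (z - α (t + 1) • ω) (x (t + 1) i)
  step_q : ∀ t ≥ 1, ∀ i,
    q (t + 1) i = clip ((1 - β (t + 1) * γ (t + 1)) • q t i + γ (t + 1) •
      (clip (P.g i t (x t i)) +
        Matrix.toEuclideanLin (P.dgClip i t (x t i)).transpose (x (t + 1) i - x t i)))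

end OnlineProblem

/-- The path length of `(y 1, …, y T)`. -/
def pathLength {p : ℕ} (T : ℕ) (y : ℕ → Vec p) : ℝ :=
  ∑ t ∈ Finset.Ico 1 T, ‖y (t + 1) - y t‖

/-- There is a directed path from any vertex to any other vertex. -/
def IsStronglyConnected {V : Type} (G : Digraph V) : Prop :=
  ∀ i j, Relation.ReflTransGen G.Adj i j

/-- The digraph on the union of the edge sets of `G t, …, G (t + B - 1)`. -/
def windowGraph {V : Type} (G : ℕ → Digraph V) (t B : ℕ) : Digraph V where
  Adj i j := ∃ l < B, (G (t + l)).Adj i j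

/-- The assumptions on the communication graphs `G t` and the mixing matrices `W t`, where
`(G t).Adj j i` means that agent `i` can receive data from agent `j` in round `t`. -/
structure MixingNetwork {n : ℕ} (G : ℕ → Digraph (Fin n)) (W : ℕ → Matrix (Fin n) (Fin n) ℝ)
    (w : ℝ) (B : ℕ) : Prop where
  weight_pos : ∀ t ≥ 1, ∀ i j, (G t).Adj j i ∨ i = j → 0 < W t i j
  weight_zero : ∀ t ≥ 1, ∀ i j, ¬ ((G t).Adj j i ∨ i = j) → W t i j = 0
  w_pos : 0 < w
  w_lt_one : w < 1
  weight_ge : ∀ t ≥ 1, ∀ i j, 0 < W t i j → w ≤ W t i j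
  doubly_stochastic : ∀ t ≥ 1, W t ∈ doublyStochastic ℝ (Fin n)
  window_pos : 0 < B
  connected : ∀ t ≥ 1, IsStronglyConnected (windowGraph G t B)

end

/-! Everything rests on one energy inequality, `energy_le`, which bounds local regret, dual
variables, projection errors and disagreement together. Write u for a clipped local constraint
value, v for the slope of the linearised constraint along the agent's move, and ε for the distance
of the new decision from the mixture before it. The variational inequality of the projection, the
subgradient inequalities and Jensen with doubly stochastic weights give, per round (`network_step`):
local regret + Σ q(u + v) + Σ ε²/(2α) is at most a weighted difference of squared distances to the
comparator plus F₂ times the total movement. The differences telescope up to the path length.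

To bound Σ q(u + v) from below, the Lyapunov function is the squared excess of q over F₁, not q².
The usual drift of q² leaves errors γu², whose sum of order T^κ is not dominated by α₀T^(1-κ) +
T^κ/α₀ uniformly in α₀. Since γu ≤ F₁, the excess has no such error (`excess_sq_step`): only terms
linear in |v| remain, and |v| is at most F₂ times the movement.

Movement is at most perturbation (the sum of the ε) plus disagreement. Products of nB mixing
matrices have all entries at least w^(nB), so Dobrushin contraction bounds summed disagreement by a
constant plus a multiple of summed perturbation (`sum_disagreement_le`). Young's inequality absorbs
the perturbation into half of ε²/(2α), at a cost Σα of order α₀T^(1-κ). Lipschitz losses then turn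
local regret into network regret at the price of disagreement.

For the violation, compare with a static feasible point: regret is at least -nF₁T, so the energy
inequality forces q to be of order √(α₀+1)·t^(κ/2). Telescoping q/γ bounds Σu by such terms plus
Σ|v| (`DualRecursion.sum_le`). If α₀ ≥ T^κ the trivial bound of order T suffices; otherwise the
energy is O(T), and Young's inequality with a balanced parameter controls Σ|v|. -/

/-! ### Estimates for real powers and weighted sums -/

/-- Bernoulli's inequality, as a lower bound on the increments of a concave power. -/
theorem rpow_increment {r : ℝ} (hr₀ : 0 < r) (hr₁ : r < 1) {t : ℝ} (ht : 0 ≤ t) :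
    t ^ (1 - r) + (1 - r) / (t + 1) ^ r ≤ (t + 1) ^ (1 - r) := by
  have h1 : (0 : ℝ) < t + 1 := by linarith
  have hb := rpow_one_add_le_one_add_mul_self (s := -(1 / (t + 1)))
    (p := 1 - r) (by rw [neg_le_neg_iff, div_le_one h1]; linarith) (by linarith) (by linarith)
  have e1 : 1 + -(1 / (t + 1)) = t / (t + 1) := by field_simp; ring
  rw [e1, Real.div_rpow ht h1.le, div_le_iff₀ (by positivity)] at hb
  have e2 : (t + 1) ^ (1 - r) = (t + 1) / (t + 1) ^ r := by
    rw [Real.rpow_sub h1, Real.rpow_one]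
  have h2 : (0 : ℝ) < (t + 1) ^ r := by positivity
  rw [e2] at hb ⊢
  have e3 : (1 + (1 - r) * -(1 / (t + 1))) * ((t + 1) / (t + 1) ^ r)
      = (t + 1) / (t + 1) ^ r - (1 - r) / (t + 1) ^ r := by field_simp; ring
  linarith

theorem sum_inv_rpow_le {r : ℝ} (hr₀ : 0 < r) (hr₁ : r < 1) (T : ℕ) :
    ∑ k ∈ Finset.range T, 1 / ((k : ℝ) + 1) ^ r ≤ (T : ℝ) ^ (1 - r) / (1 - r) := by
  have h1 : 0 < 1 - r := by linarith
  induction T with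
  | zero => simp [Real.zero_rpow h1.ne']
  | succ T ih =>
    rw [Finset.sum_range_succ]
    have := rpow_increment hr₀ hr₁ (Nat.cast_nonneg (α := ℝ) T)
    rw [le_div_iff₀ h1] at ih ⊢
    push_cast
    have e : 1 / ((T : ℝ) + 1) ^ r * (1 - r) = (1 - r) / ((T : ℝ) + 1) ^ r := by ring
    rw [add_mul, e]
    linarith

/-- The weight 1/γ = t^(1-κ) of the dual Lyapunov function grows no faster than the decay βγ = 1/t
allows. -/
theorem mul_div_rpow_succ_le {κ t : ℝ} (hκ₀ : 0 < κ) (ht : 0 < t) :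
    t / (t + 1) ^ κ ≤ t ^ (1 - κ) := by
  rw [Real.rpow_sub ht, Real.rpow_one]
  gcongr
  linarith

/-- Bernoulli gives (1 + 1/t)^κ ≤ 1 + 1/t, and (t - 1)(1 + 1/t) ≤ t. This complements the preceding
bound: weight growth and decay cancel up to 1/t^κ. -/
theorem rpow_sub_le_mul_div_rpow_succ {κ t : ℝ} (hκ₀ : 0 < κ) (hκ₁ : κ < 1) (ht : 1 ≤ t) :
    t ^ (1 - κ) - 1 / t ^ κ ≤ t / (t + 1) ^ κ := by
  have ht0 : 0 < t := by linarith
  have hb := rpow_one_add_le_one_add_mul_self (s := 1 / t)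
    (p := κ) (by have : 0 < 1 / t := by positivity
                 linarith) hκ₀.le hκ₁.le
  have e1 : 1 + 1 / t = (t + 1) / t := by field_simp
  rw [e1, Real.div_rpow (by linarith) ht0.le, div_le_iff₀ (by positivity)] at hb
  rw [Real.rpow_sub ht0, Real.rpow_one, ← sub_div, div_le_div_iff₀ (by positivity) (by positivity)]
  have hk : 0 < t ^ κ := by positivity
  calc (t - 1) * (t + 1) ^ κ ≤ (t - 1) * ((1 + κ * (1 / t)) * t ^ κ) := by
        gcongr
    _ ≤ (t - 1) * ((1 + 1 * (1 / t)) * t ^ κ) := by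
        have : 0 ≤ t - 1 := by linarith
        gcongr
    _ = (t - 1 / t) * t ^ κ := by field_simp; ring
    _ ≤ t * t ^ κ := by
        gcongr
        have : 0 < 1 / t := by positivity
        linarith

theorem rpow_succ_le_two_mul {r t : ℝ} (hr₀ : 0 ≤ r) (hr₁ : r ≤ 1) (ht : 1 ≤ t) :
    (t + 1) ^ r ≤ 2 * t ^ r := by
  calc (t + 1) ^ r ≤ (2 * t) ^ r := by gcongr; linarith
    _ = 2 ^ r * t ^ r := Real.mul_rpow (by norm_num) (by linarith)
    _ ≤ 2 ^ (1 : ℝ) * t ^ r := by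
        have : (0 : ℝ) ≤ t ^ r := Real.rpow_nonneg (by linarith) _
        gcongr
        norm_num
    _ = 2 * t ^ r := by norm_num

/-- A weighted telescoping sum with nondecreasing weights and a drifting reference. -/
theorem weighted_telescope {h a b d : ℕ → ℝ} {M : ℝ} (hh₀ : ∀ k, 0 ≤ h k)
    (hh : ∀ k, h k ≤ h (k + 1)) (hd : ∀ k, 0 ≤ d k) (S : ℕ) (ha : a 0 ≤ M)
    (hb : ∀ k ≤ S, b k ≤ M) (hab : ∀ k < S, a (k + 1) ≤ b k + d k) :
    ∑ k ∈ Finset.range (S + 1), h k * (a k - b k) ≤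
      h S * (M + ∑ k ∈ Finset.range S, d k - b S) := by
  induction S with
  | zero =>
    simp only [zero_add, Finset.sum_range_one, Finset.sum_range_zero, add_zero]
    have := hh₀ 0
    gcongr
  | succ S ih =>
    specialize ih (fun k hk => hb k (by omega)) fun k hk => hab k (by omega)
    rw [Finset.sum_range_succ _ (S + 1), Finset.sum_range_succ d S]
    have hs : 0 ≤ ∑ k ∈ Finset.range S, d k := Finset.sum_nonneg fun k _ => hd k
    have h1 : h S * (M + ∑ k ∈ Finset.range S, d k - b S) ≤
        h (S + 1) * (M + ∑ k ∈ Finset.range S, d k - b S) :=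
      mul_le_mul_of_nonneg_right (hh S) (by have := hb S (by omega); linarith)
    have h2 := mul_le_mul_of_nonneg_left (hab S (by omega)) (hh₀ (S + 1))
    nlinarith

/-! ### The scalar dual recursion -/

/-- One step of the scalar dual recursion, for the square of the excess over `s`. -/
theorem excess_sq_step {q u v c γ s K M : ℝ} (hq : 0 ≤ q) (hc₀ : 0 ≤ c) (hc₁ : c ≤ 1)
    (hγ₀ : 0 ≤ γ) (hγ₁ : γ ≤ 1) (hu : 0 ≤ u) (hus : u ≤ s) (hv : |v| ≤ M)
    (hK : q - c * q ≤ K) :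
    max (max (c * q + γ * (u + v)) 0 - s) 0 ^ 2 ≤
      c * max (q - s) 0 ^ 2 + 2 * γ * (q * (u + v)) + γ * ((2 * (K + s) + M) * |v|) := by
  have hs : 0 ≤ s := hu.trans hus
  have hqc : c * q ≤ q := by nlinarith
  have hcq : 0 ≤ c * q := by positivity
  have hγu : γ * u ≤ s := by nlinarith
  have hγu₀ : 0 ≤ γ * u := by positivity
  -- The excess after a step with u alone. The positive part is monotone and 1-Lipschitz, so v
  -- enters only as the perturbation γv of a.
  set a := max (c * q + γ * u - s) 0 with ha
  have ha₀ : 0 ≤ a := le_max_right _ _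
  have haq : a ≤ q := max_le (by linarith) hq
  have haq' : q - K - s ≤ a := le_trans (by linarith) (le_max_left _ _)
  have hA : max (max (c * q + γ * (u + v)) 0 - s) 0 ^ 2 ≤ (a + γ * v) ^ 2 := by
    have h1 : max (max (c * q + γ * (u + v)) 0 - s) 0 ≤ |a + γ * v| := by
      refine max_le ?_ (abs_nonneg _)
      rw [sub_le_iff_le_add]
      refine max_le ?_ (by have := abs_nonneg (a + γ * v); linarith)
      have : c * q + γ * u - s ≤ a := le_max_left _ _
      have := le_abs_self (a + γ * v)
      linarith
    calc _ ≤ |a + γ * v| ^ 2 := by gcongr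
      _ = _ := sq_abs _
  -- No error of order γu² survives: γu ≤ s gives (γu)² ≤ γus, and above the threshold 2γu(q - s) +
  -- γus ≤ 2γuq. Below it, a ≤ γu and a ≤ q suffice.
  have hB : a ^ 2 ≤ c * max (q - s) 0 ^ 2 + 2 * γ * (q * u) := by
    set b := max (q - s) 0 with hb
    have hb₀ : 0 ≤ b := le_max_right _ _
    have hbs : q - s ≤ b := le_max_left _ _
    have hab : a ≤ c * b + γ * u := by
      refine max_le ?_ (by positivity)
      nlinarith
    have hacq : a ≤ c * q := max_le (by linarith) hcq
    have hsq : 0 ≤ s * q := by positivity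
    rcases le_total q s with h | h
    · have : b = 0 := max_eq_right (by linarith)
      rw [this] at hab ⊢
      nlinarith [mul_nonneg hγu₀ hq]
    · have hbe : b = q - s := max_eq_left (by linarith)
      have h1 : a ^ 2 ≤ (c * b + γ * u) ^ 2 := by gcongr
      have h2 : (γ * u) ^ 2 ≤ γ * u * s := by nlinarith
      have h3 : (c * b) ^ 2 ≤ c * b ^ 2 := by
        have : c ^ 2 ≤ c := by nlinarith
        rw [mul_pow]; gcongr
      have h4 : c * b * (γ * u) ≤ b * (γ * u) := by
        have : c * b ≤ b := by nlinarith
        gcongr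
      rw [hbe] at *
      nlinarith
  -- Replacing a by q in the cross term costs |a - q| ≤ K + s, so the error stays linear in |v|.
  have hC : 2 * a * (γ * v) ≤ 2 * γ * (q * v) + γ * (2 * (K + s) * |v|) := by
    have : (a - q) * v ≤ (K + s) * |v| := by
      calc (a - q) * v ≤ |(a - q) * v| := le_abs_self _
        _ = |a - q| * |v| := abs_mul _ _
        _ ≤ (K + s) * |v| := by
          gcongr
          rw [abs_le]; constructor <;> linarith
    nlinarith
  have hD : (γ * v) ^ 2 ≤ γ * (M * |v|) := by
    have h1 : v ^ 2 ≤ M * |v| := by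
      rw [← sq_abs, sq]; gcongr
    have h2 : 0 ≤ v ^ 2 := sq_nonneg v
    have : γ ^ 2 ≤ γ := by nlinarith
    calc (γ * v) ^ 2 = γ ^ 2 * v ^ 2 := by ring
      _ ≤ γ * v ^ 2 := by gcongr
      _ ≤ _ := by gcongr
  nlinarith

/-- One coordinate of the dual iteration. -/
structure DualRecursion (κ F M : ℝ) (q u v : ℕ → ℝ) : Prop where
  kappa_pos : 0 < κ
  kappa_lt_one : κ < 1
  init : q 1 = 0
  nonneg : ∀ k, 0 ≤ u k
  le : ∀ k, u k ≤ F
  abs_le : ∀ k, |v k| ≤ M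
  step : ∀ k : ℕ, q (k + 2) = max ((1 - 1 / ((k : ℝ) + 2)) * q (k + 1) +
    1 / ((k : ℝ) + 2) ^ (1 - κ) * (u k + v k)) 0

namespace DualRecursion

variable {κ F M : ℝ} {q u v : ℕ → ℝ}

theorem q_nonneg (h : DualRecursion κ F M q u v) (k : ℕ) : 0 ≤ q (k + 1) := by
  cases k with
  | zero => simp [h.init]
  | succ k => rw [h.step]; exact le_max_right _ _

/-- Since γ = t^κ/t, the step is at most a convex combination, with weights 1 - 1/t and 1/t, of the
old value and (F + M)t^κ. -/
theorem q_le (h : DualRecursion κ F M q u v) (k : ℕ) :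
    q (k + 1) ≤ (F + M) * ((k : ℝ) + 1) ^ κ := by
  have hF : 0 ≤ F := (h.nonneg 0).trans (h.le 0)
  have hM : 0 ≤ M := (abs_nonneg _).trans (h.abs_le 0)
  induction k with
  | zero => simp [h.init]; positivity
  | succ k ih =>
    rw [h.step]
    refine max_le ?_ (by positivity)
    have hk : (0 : ℝ) < (k : ℝ) + 2 := by positivity
    have h1 : u k + v k ≤ F + M := add_le_add (h.le k) ((le_abs_self _).trans (h.abs_le k))
    have h2 : ((k : ℝ) + 1) ^ κ ≤ ((k : ℝ) + 2) ^ κ :=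
      Real.rpow_le_rpow (by positivity) (by linarith) h.kappa_pos.le
    have h3 : (0 : ℝ) ≤ 1 - 1 / ((k : ℝ) + 2) := by
      rw [sub_nonneg, div_le_one hk]; linarith
    have e : 1 / ((k : ℝ) + 2) ^ (1 - κ) = ((k : ℝ) + 2) ^ κ / ((k : ℝ) + 2) := by
      rw [Real.rpow_sub hk, Real.rpow_one]; field_simp
    push_cast
    rw [e, show (k : ℝ) + 1 + 1 = k + 2 by ring]
    calc (1 - 1 / ((k : ℝ) + 2)) * q (k + 1) + ((k : ℝ) + 2) ^ κ / ((k : ℝ) + 2) * (u k + v k)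
        ≤ (1 - 1 / ((k : ℝ) + 2)) * ((F + M) * ((k : ℝ) + 2) ^ κ) +
          ((k : ℝ) + 2) ^ κ / ((k : ℝ) + 2) * (F + M) := by
          gcongr
          exact ih.trans (by gcongr)
      _ = (F + M) * ((k : ℝ) + 2) ^ κ := by field_simp; ring

/-- The drift of the excess of the dual variable over `F`. -/
theorem excess_sq_le (h : DualRecursion κ F M q u v) (T : ℕ) :
    1 / 2 * (max (q (T + 1) - F) 0 ^ 2 * ((T : ℝ) + 1) ^ (1 - κ)) ≤
      ∑ k ∈ Finset.range T, q (k + 1) * (u k + v k) +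
        (2 * (F + M)) * ∑ k ∈ Finset.range T, |v k| := by
  have hF : 0 ≤ F := (h.nonneg 0).trans (h.le 0)
  have hM : 0 ≤ M := (abs_nonneg _).trans (h.abs_le 0)
  induction T with
  | zero => simp [h.init, hF]
  | succ T ih =>
    rw [Finset.sum_range_succ, Finset.sum_range_succ]
    have hT : (0 : ℝ) < (T : ℝ) + 2 := by positivity
    have hTp : (0 : ℝ) < ((T : ℝ) + 2) ^ (1 - κ) := by positivity
    have hT1 : (1 : ℝ) ≤ ((T : ℝ) + 2) ^ (1 - κ) :=
      Real.one_le_rpow (by linarith [Nat.cast_nonneg (α := ℝ) T]) (by linarith [h.kappa_lt_one])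
    -- The crude growth t^κ ≤ t shows that the decay 1/t removes at most F + M from q in any round.
    have hK : q (T + 1) - (1 - 1 / ((T : ℝ) + 2)) * q (T + 1) ≤ F + M := by
      have h1 : ((T : ℝ) + 1) ^ κ ≤ (T : ℝ) + 2 := by
        calc ((T : ℝ) + 1) ^ κ ≤ ((T : ℝ) + 1) ^ (1 : ℝ) :=
              Real.rpow_le_rpow_of_exponent_le (by linarith [Nat.cast_nonneg (α := ℝ) T])
                h.kappa_lt_one.le
          _ ≤ _ := by rw [Real.rpow_one]; linarith
      have h2 : q (T + 1) ≤ (F + M) * ((T : ℝ) + 2) := (h.q_le T).trans (by gcongr)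
      have e : q (T + 1) - (1 - 1 / ((T : ℝ) + 2)) * q (T + 1) = q (T + 1) / ((T : ℝ) + 2) := by
        field_simp; ring
      rw [e, div_le_iff₀ hT]; exact h2
    have hstep := excess_sq_step (c := 1 - 1 / ((T : ℝ) + 2))
      (γ := 1 / ((T : ℝ) + 2) ^ (1 - κ)) (h.q_nonneg T)
      (by rw [sub_nonneg, div_le_one hT]; linarith) (by
        have : (0 : ℝ) < 1 / ((T : ℝ) + 2) := by positivity
        linarith) (by positivity) (by rw [div_le_one hTp]; exact hT1) (h.nonneg T) (h.le T)
      (h.abs_le T) hK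
    rw [← h.step] at hstep
    have h5 := mul_le_mul_of_nonneg_right hstep hTp.le
    -- After multiplication by 1/γ the decay factor pays for the increase of the weight, so the
    -- weighted excess telescopes.
    have e1 : (1 - 1 / ((T : ℝ) + 2)) * ((T : ℝ) + 2) ^ (1 - κ) ≤ ((T : ℝ) + 1) ^ (1 - κ) := by
      have := mul_div_rpow_succ_le h.kappa_pos (t := (T : ℝ) + 1) (by positivity)
      refine le_trans (le_of_eq ?_) this
      rw [show (T : ℝ) + 1 + 1 = T + 2 by ring, Real.rpow_sub hT, Real.rpow_one]
      field_simp
      ring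
    have e2 := mul_le_mul_of_nonneg_left e1 (sq_nonneg (max (q (T + 1) - F) 0))
    have e3 : 1 / ((T : ℝ) + 2) ^ (1 - κ) * ((T : ℝ) + 2) ^ (1 - κ) = 1 :=
      one_div_mul_cancel hTp.ne'
    push_cast
    rw [show (T : ℝ) + 1 + 1 = T + 2 by ring, show T + 1 + 1 = T + 2 by ring]
    have h6 : max (q (T + 2) - F) 0 ^ 2 * ((T : ℝ) + 2) ^ (1 - κ) ≤
        max (q (T + 1) - F) 0 ^ 2 * ((T : ℝ) + 1) ^ (1 - κ) + 2 * (q (T + 1) * (u T + v T)) +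
          (2 * ((F + M) + F) + M) * |v T| := by
      calc _ ≤ _ := h5
        _ = max (q (T + 1) - F) 0 ^ 2 * ((1 - 1 / ((T : ℝ) + 2)) * ((T : ℝ) + 2) ^ (1 - κ)) +
            (2 * (q (T + 1) * (u T + v T)) + (2 * ((F + M) + F) + M) * |v T|) *
              (1 / ((T : ℝ) + 2) ^ (1 - κ) * ((T : ℝ) + 2) ^ (1 - κ)) := by ring
        _ ≤ _ := by rw [e3]; linarith
    have h7 := abs_nonneg (v T)
    have h8 := mul_nonneg hM h7
    nlinarith

/-- Dropping the outer clipping and dividing by γ bounds u + v by a difference of weighted dual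
variables. The weights match only up to 1/t^κ, which produces the sum of q/t^κ. -/
theorem sum_le (h : DualRecursion κ F M q u v) (T : ℕ) :
    ∑ k ∈ Finset.range T, u k ≤ ((T : ℝ) + 1) ^ (1 - κ) * q (T + 1) +
      ∑ k ∈ Finset.range T, 1 / ((k : ℝ) + 1) ^ κ * q (k + 1) +
        ∑ k ∈ Finset.range T, |v k| := by
  induction T with
  | zero => simp [h.init]
  | succ T ih =>
    rw [Finset.sum_range_succ, Finset.sum_range_succ, Finset.sum_range_succ]
    have hT : (0 : ℝ) < (T : ℝ) + 2 := by positivity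
    have hTp : (0 : ℝ) < ((T : ℝ) + 2) ^ (1 - κ) := by positivity
    have h1 := le_max_left ((1 - 1 / ((T : ℝ) + 2)) * q (T + 1) +
      1 / ((T : ℝ) + 2) ^ (1 - κ) * (u T + v T)) 0
    rw [← h.step] at h1
    have h2 := mul_le_mul_of_nonneg_left h1 hTp.le
    have e : ((T : ℝ) + 2) ^ (1 - κ) * ((1 - 1 / ((T : ℝ) + 2)) * q (T + 1) +
        1 / ((T : ℝ) + 2) ^ (1 - κ) * (u T + v T)) =
        ((T : ℝ) + 1) / ((T : ℝ) + 2) ^ κ * q (T + 1) + (u T + v T) := by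
      rw [mul_add, ← mul_assoc, ← mul_assoc, mul_one_div_cancel hTp.ne', one_mul,
        Real.rpow_sub hT, Real.rpow_one]
      congr 2
      field_simp
      ring
    rw [e] at h2
    have h3 := rpow_sub_le_mul_div_rpow_succ h.kappa_pos h.kappa_lt_one
      (t := (T : ℝ) + 1) (by linarith [Nat.cast_nonneg (α := ℝ) T])
    rw [show (T : ℝ) + 1 + 1 = T + 2 by ring] at h3
    have h4 := mul_le_mul_of_nonneg_right h3 (h.q_nonneg T)
    push_cast
    rw [show (T : ℝ) + 1 + 1 = T + 2 by ring, show T + 1 + 1 = T + 2 by ring]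
    have := neg_abs_le (v T)
    nlinarith

end DualRecursion

/-! ### Mixing over jointly connected graphs -/

/-- The transition matrix of `k` rounds of mixing that start in round `s`. -/
noncomputable def transition {n : ℕ} (W : ℕ → Matrix (Fin n) (Fin n) ℝ) (s : ℕ) :
    ℕ → Matrix (Fin n) (Fin n) ℝ
  | 0 => 1
  | k + 1 => W (s + k) * transition W s k

namespace MixingNetwork

variable {n : ℕ} {G : ℕ → Digraph (Fin n)} {W : ℕ → Matrix (Fin n) (Fin n) ℝ} {w : ℝ} {B : ℕ}

theorem nonneg (h : MixingNetwork G W w B) {t : ℕ} (ht : 1 ≤ t) (i j : Fin n) : 0 ≤ W t i j :=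
  nonneg_of_mem_doublyStochastic (h.doubly_stochastic t ht)

theorem row_sum (h : MixingNetwork G W w B) {t : ℕ} (ht : 1 ≤ t) (i : Fin n) :
    ∑ j, W t i j = 1 :=
  sum_row_of_mem_doublyStochastic (h.doubly_stochastic t ht) i

theorem col_sum (h : MixingNetwork G W w B) {t : ℕ} (ht : 1 ≤ t) (j : Fin n) :
    ∑ i, W t i j = 1 :=
  sum_col_of_mem_doublyStochastic (h.doubly_stochastic t ht) j

theorem le_one (h : MixingNetwork G W w B) {t : ℕ} (ht : 1 ≤ t) (i j : Fin n) : W t i j ≤ 1 := by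
  rw [← h.row_sum ht i]
  exact Finset.single_le_sum (f := fun j => W t i j) (fun k _ => h.nonneg ht i k)
    (Finset.mem_univ j)

theorem transition_mem (h : MixingNetwork G W w B) {s : ℕ} (hs : 1 ≤ s) (k : ℕ) :
    transition W s k ∈ doublyStochastic ℝ (Fin n) := by
  induction k with
  | zero => exact Submonoid.one_mem _
  | succ k ih => exact Submonoid.mul_mem _ (h.doubly_stochastic _ (by omega)) ih

theorem transition_nonneg (h : MixingNetwork G W w B) {s : ℕ} (hs : 1 ≤ s) (k : ℕ)
    (i j : Fin n) : 0 ≤ transition W s k i j :=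
  nonneg_of_mem_doublyStochastic (h.transition_mem hs k)

theorem pow_le_transition_succ (h : MixingNetwork G W w B) {s : ℕ} (hs : 1 ≤ s) {k : ℕ}
    {i j l : Fin n} (hl : (G (s + k)).Adj l i ∨ i = l) (hjl : w ^ k ≤ transition W s k l j) :
    w ^ (k + 1) ≤ transition W s (k + 1) i j := by
  have hsk : 1 ≤ s + k := by omega
  have hw := h.weight_ge _ hsk i l (h.weight_pos _ hsk i l hl)
  calc w ^ (k + 1) = w * w ^ k := by ring
    _ ≤ W (s + k) i l * transition W s k l j :=
        mul_le_mul hw hjl (pow_nonneg h.w_pos.le _) (h.nonneg hsk _ _)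
    _ ≤ ∑ l, W (s + k) i l * transition W s k l j :=
        Finset.single_le_sum (f := fun l => W (s + k) i l * transition W s k l j)
          (fun l _ => mul_nonneg (h.nonneg hsk _ _) (h.transition_nonneg hs _ _ _))
          (Finset.mem_univ l)
    _ = _ := rfl

theorem pow_le_transition_add (h : MixingNetwork G W w B) {s : ℕ} (hs : 1 ≤ s) {k : ℕ}
    {i j : Fin n} (hij : w ^ k ≤ transition W s k i j) (d : ℕ) :
    w ^ (k + d) ≤ transition W s (k + d) i j := by
  induction d with
  | zero => exact hij
  | succ d ih => exact h.pow_le_transition_succ hs (Or.inr rfl) ih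

open Classical in
/-- After each further window, the value of `j` has reached at least one more agent. -/
theorem card_reached (h : MixingNetwork G W w B) {s : ℕ} (hs : 1 ≤ s) (j : Fin n) (k : ℕ) :
    min n (k + 1) ≤
      (Finset.univ.filter fun i => w ^ (k * B) ≤ transition W s (k * B) i j).card := by
  induction k with
  | zero =>
    refine (min_le_right _ _).trans ?_
    rw [zero_add, Nat.one_le_iff_ne_zero, ← Nat.pos_iff_ne_zero, Finset.card_pos]
    exact ⟨j, by simp [transition]⟩
  | succ k ih =>
    set S := Finset.univ.filter fun i => w ^ (k * B) ≤ transition W s (k * B) i j with hS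
    set S' := Finset.univ.filter
      fun i => w ^ ((k + 1) * B) ≤ transition W s ((k + 1) * B) i j with hS'
    have hsub : S ⊆ S' := by
      intro i hi
      simp only [hS, hS', Finset.mem_filter, Finset.mem_univ, true_and] at hi ⊢
      rw [add_mul, one_mul]
      exact h.pow_le_transition_add hs hi B
    by_cases hall : S = Finset.univ
    · have : S' = Finset.univ := Finset.univ_subset_iff.mp (hall ▸ hsub)
      rw [this, Finset.card_univ, Fintype.card_fin]
      exact min_le_left _ _
    · have hjS : ∃ a, a ∈ S := by
        rw [← Finset.Nonempty, ← Finset.card_pos]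
        have : 0 < n := j.pos
        omega
      obtain ⟨a, ha⟩ := hjS
      obtain ⟨b, hb⟩ : ∃ b, b ∉ S := by
        by_contra! hc
        exact hall (Finset.eq_univ_iff_forall.mpr hc)
      -- A path in the window graph from inside the reached set to outside it must cross its
      -- boundary.
      obtain ⟨c, hc, d, hd, hcd⟩ : ∃ c ∈ S, ∃ d ∉ S, (windowGraph G (s + k * B) B).Adj c d := by
        by_contra! hno
        refine hb ?_
        have hpath := h.connected (s + k * B) (by omega) a b
        clear hb
        induction hpath with
        | refl => exact ha
        | tail _ hstep ih' =>
          by_contra hb'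
          exact hno _ ih' _ hb' hstep
      obtain ⟨l, hl, hadj⟩ := hcd
      have hdS' : d ∈ S' := by
        simp only [hS, hS', Finset.mem_filter, Finset.mem_univ, true_and] at hc ⊢
        have h1 := h.pow_le_transition_add hs hc l
        have h2 := h.pow_le_transition_succ hs (i := d)
          (Or.inl (by rw [← add_assoc]; exact hadj)) h1
        -- After the crossing edge, the positive diagonal entries carry the weight to the end of the
        -- window.
        have h3 := h.pow_le_transition_add hs h2 (B - (l + 1))
        have e : k * B + l + 1 + (B - (l + 1)) = (k + 1) * B := by
          rw [add_mul, one_mul]; omega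
        rwa [e] at h3
      have hlt : S.card < S'.card :=
        Finset.card_lt_card ⟨hsub, fun hc' => hd (hc' hdS')⟩
      omega

theorem pow_le_transition (h : MixingNetwork G W w B) {s : ℕ} (hs : 1 ≤ s) (i j : Fin n) :
    w ^ (n * B) ≤ transition W s (n * B) i j := by
  classical
  have h1 := h.card_reached hs j n
  rw [min_eq_left (by omega)] at h1
  have h2 := (Finset.card_eq_iff_eq_univ _).mp
    (le_antisymm (Finset.card_le_univ _) (by rwa [Fintype.card_fin]))
  have := Finset.eq_univ_iff_forall.mp h2 i
  simpa using this

end MixingNetwork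

/-! ### Contraction and summed disagreement -/

section Contraction

variable {n : ℕ} {E : Type*} [NormedAddCommGroup E] [NormedSpace ℝ E]

theorem norm_convex_combination_le {c : Fin n → ℝ} {y : Fin n → E} {r : ℝ} (hc : ∀ i, 0 ≤ c i)
    (hsum : ∑ i, c i = 1) (hy : ∀ i, ‖y i‖ ≤ r) : ‖∑ i, c i • y i‖ ≤ r := by
  calc ‖∑ i, c i • y i‖ ≤ ∑ i, ‖c i • y i‖ := norm_sum_le _ _
    _ ≤ ∑ i, c i * r := by
        gcongr with i
        rw [norm_smul, Real.norm_of_nonneg (hc i)]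
        exact mul_le_mul_of_nonneg_left (hy i) (hc i)
    _ = r := by rw [← Finset.sum_mul, hsum, one_mul]

/-- Dobrushin's contraction of the diameter under two rows with entries at least `δ`. -/
theorem norm_rows_sub_le {a b : Fin n → ℝ} {y : Fin n → E} {δ D : ℝ} (hn : 0 < n) (hδ : 0 ≤ δ)
    (ha : ∀ i, δ ≤ a i) (hb : ∀ i, δ ≤ b i) (hsa : ∑ i, a i = 1) (hsb : ∑ i, b i = 1)
    (hy : ∀ i j, ‖y i - y j‖ ≤ D) : ‖∑ i, a i • y i - ∑ i, b i • y i‖ ≤ (1 - δ) * D := by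
  have : NeZero n := ⟨hn.ne'⟩
  have hD : 0 ≤ D := (norm_nonneg _).trans (hy 0 0)
  set a' : Fin n → ℝ := fun i => a i - δ with ha'
  set b' : Fin n → ℝ := fun i => b i - δ with hb'
  set ρ : ℝ := 1 - n * δ with hρ
  have sa : ∑ i, a' i = ρ := by simp [ha', Finset.sum_sub_distrib, hsa, hρ]
  have sb : ∑ i, b' i = ρ := by simp [hb', Finset.sum_sub_distrib, hsb, hρ]
  have pa : ∀ i, 0 ≤ a' i := fun i => sub_nonneg.mpr (ha i)
  have pb : ∀ i, 0 ≤ b' i := fun i => sub_nonneg.mpr (hb i)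
  have hρ₀ : 0 ≤ ρ := sa ▸ Finset.sum_nonneg fun i _ => pa i
  have hρ₁ : ρ ≤ 1 - δ := by
    have : (1 : ℝ) ≤ n := by exact_mod_cast hn
    rw [hρ]; nlinarith
  refine le_trans ?_ (mul_le_mul_of_nonneg_right hρ₁ hD)
  have e : ∑ i, a i • y i - ∑ i, b i • y i = ∑ i, a' i • y i - ∑ i, b' i • y i := by
    simp only [ha', hb', sub_smul, Finset.sum_sub_distrib]; abel
  rw [e]
  rcases hρ₀.eq_or_lt with h0 | hpos
  · have za : ∀ i, a' i = 0 := fun i =>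
      (Finset.sum_eq_zero_iff_of_nonneg fun i _ => pa i).mp (sa.trans h0.symm) i
        (Finset.mem_univ i)
    have zb : ∀ i, b' i = 0 := fun i =>
      (Finset.sum_eq_zero_iff_of_nonneg fun i _ => pb i).mp (sb.trans h0.symm) i
        (Finset.mem_univ i)
    simp [za, zb, ← h0]
  -- After removal of the common part δ both rows have mass ρ, so the difference is an average of
  -- pairwise differences under the product coupling.
  · have e2 : ρ • (∑ i, a' i • y i - ∑ i, b' i • y i) =
        ∑ i, ∑ j, (a' i * b' j) • (y i - y j) := by
      simp only [smul_sub, Finset.sum_sub_distrib]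
      congr 1
      · rw [Finset.smul_sum]
        refine Finset.sum_congr rfl fun i _ => ?_
        rw [← Finset.sum_smul, ← Finset.mul_sum, sb, smul_smul, mul_comm]
      · rw [Finset.smul_sum, Finset.sum_comm]
        refine Finset.sum_congr rfl fun j _ => ?_
        rw [← Finset.sum_smul, ← Finset.sum_mul, sa, smul_smul]
    have h3 : ρ * ‖∑ i, a' i • y i - ∑ i, b' i • y i‖ ≤ ρ * (ρ * D) := by
      rw [← Real.norm_of_nonneg hρ₀, ← norm_smul, Real.norm_of_nonneg hρ₀, e2]
      calc ‖∑ i, ∑ j, (a' i * b' j) • (y i - y j)‖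
          ≤ ∑ i, ∑ j, ‖(a' i * b' j) • (y i - y j)‖ :=
            (norm_sum_le _ _).trans (Finset.sum_le_sum fun i _ => norm_sum_le _ _)
        _ ≤ ∑ i, ∑ j, a' i * b' j * D := by
            gcongr with i _ j _
            rw [norm_smul, Real.norm_of_nonneg (mul_nonneg (pa i) (pb j))]
            exact mul_le_mul_of_nonneg_left (hy i j) (mul_nonneg (pa i) (pb j))
        _ = ρ * (ρ * D) := by
            simp only [mul_assoc, ← Finset.mul_sum, ← Finset.sum_mul, sa, sb]
    exact le_of_mul_le_mul_left h3 hpos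

end Contraction

/-- Summation of a perturbed contraction with a delay of `N` rounds. -/
theorem sum_le_of_delayed_contraction {a e : ℕ → ℝ} {N : ℕ} {ρ M c : ℝ} (hρ : 0 ≤ ρ)
    (hc : 0 ≤ c) (ha₀ : ∀ k, 0 ≤ a k) (he₀ : ∀ k, 0 ≤ e k) (ha : ∀ k, a k ≤ M)
    (hstep : ∀ k, a (N + k) ≤ ρ * a k + c * ∑ l ∈ Finset.range N, e (k + l)) (T : ℕ) :
    (1 - ρ) * ∑ k ∈ Finset.range T, a k ≤ N * M + c * N * ∑ k ∈ Finset.range T, e k := by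
  have hM : 0 ≤ M := (ha₀ 0).trans (ha 0)
  have hA : 0 ≤ ∑ k ∈ Finset.range T, a k := Finset.sum_nonneg fun k _ => ha₀ k
  have hE : 0 ≤ ∑ k ∈ Finset.range T, e k := Finset.sum_nonneg fun k _ => he₀ k
  rcases le_total T N with h | h
  · have h1 : ∑ k ∈ Finset.range T, a k ≤ N * M := by
      calc ∑ k ∈ Finset.range T, a k ≤ ∑ _k ∈ Finset.range T, M := by gcongr with k; exact ha k
        _ = T * M := by simp
        _ ≤ N * M := by gcongr
    have : 0 ≤ c * N * ∑ k ∈ Finset.range T, e k := by positivity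
    nlinarith
  · obtain ⟨K, rfl⟩ := Nat.exists_eq_add_of_le h
    have h1 : ∑ k ∈ Finset.range N, a k ≤ N * M := by
      calc ∑ k ∈ Finset.range N, a k ≤ ∑ _k ∈ Finset.range N, M := by gcongr with k; exact ha k
        _ = N * M := by simp
    have h2 : ∑ k ∈ Finset.range K, a k ≤ ∑ k ∈ Finset.range (N + K), a k :=
      Finset.sum_le_sum_of_subset_of_nonneg (Finset.range_mono (by omega)) fun k _ _ => ha₀ k
    have h3 : ∑ k ∈ Finset.range K, ∑ l ∈ Finset.range N, e (k + l) ≤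
        N * ∑ k ∈ Finset.range (N + K), e k := by
      rw [Finset.sum_comm]
      calc ∑ l ∈ Finset.range N, ∑ k ∈ Finset.range K, e (k + l)
          ≤ ∑ _l ∈ Finset.range N, ∑ k ∈ Finset.range (N + K), e k := by
            refine Finset.sum_le_sum fun l hl => ?_
            rw [Finset.mem_range] at hl
            calc ∑ k ∈ Finset.range K, e (k + l)
                = ∑ k ∈ (Finset.range K).map (addRightEmbedding l), e k := by simp
              _ ≤ _ := by
                refine Finset.sum_le_sum_of_subset_of_nonneg ?_ fun k _ _ => he₀ k
                intro k hk
                simp only [Finset.mem_map, Finset.mem_range, addRightEmbedding_apply] at hk ⊢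
                obtain ⟨b, hb, rfl⟩ := hk
                omega
        _ = _ := by simp
    have h4 : ∑ k ∈ Finset.range (N + K), a k ≤ N * M + ρ * ∑ k ∈ Finset.range K, a k +
        c * ∑ k ∈ Finset.range K, ∑ l ∈ Finset.range N, e (k + l) := by
      rw [Finset.sum_range_add, Finset.mul_sum, Finset.mul_sum, add_assoc,
        ← Finset.sum_add_distrib]
      exact add_le_add h1 (Finset.sum_le_sum fun k _ => hstep k)
    have h5 := mul_le_mul_of_nonneg_left h2 hρ
    have h6 := mul_le_mul_of_nonneg_left h3 hc
    nlinarith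

section Consensus

variable {n p : ℕ}

/-- The total pairwise disagreement of the agents' decisions. -/
noncomputable def disagreement (y : Fin n → Vec p) : ℝ := ∑ i, ∑ j, ‖y i - y j‖

/-- The total deviation of `y'` from the mixture of `y` with weights `A`. -/
noncomputable def perturbation (A : Matrix (Fin n) (Fin n) ℝ) (y y' : Fin n → Vec p) : ℝ :=
  ∑ i, ‖y' i - ∑ j, A i j • y j‖

variable {G : ℕ → Digraph (Fin n)} {W : ℕ → Matrix (Fin n) (Fin n) ℝ} {w : ℝ} {B : ℕ}

/-- Later mixing is an average and does not enlarge an earlier error, so errors merely add up. -/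
theorem norm_sub_transition_le (h : MixingNetwork G W w B) (x : ℕ → Fin n → Vec p) {s : ℕ}
    (hs : 1 ≤ s) (k : ℕ) (i : Fin n) :
    ‖x (s + k) i - ∑ j, transition W s k i j • x s j‖ ≤
      ∑ l ∈ Finset.range k, perturbation (W (s + l)) (x (s + l)) (x (s + l + 1)) := by
  induction k generalizing i with
  | zero => simp [transition, Matrix.one_apply]
  | succ k ih =>
    have hsk : 1 ≤ s + k := by omega
    have e : x (s + (k + 1)) i - ∑ j, transition W s (k + 1) i j • x s j =
        (∑ l, W (s + k) i l • (x (s + k) l - ∑ j, transition W s k l j • x s j)) +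
          (x (s + k + 1) i - ∑ l, W (s + k) i l • x (s + k) l) := by
      have : ∑ j, transition W s (k + 1) i j • x s j =
          ∑ l, W (s + k) i l • ∑ j, transition W s k l j • x s j := by
        simp only [transition, Matrix.mul_apply, Finset.sum_smul, Finset.smul_sum, smul_smul]
        exact Finset.sum_comm
      rw [this]
      simp only [smul_sub, Finset.sum_sub_distrib]
      rw [← add_assoc]
      abel
    rw [e, Finset.sum_range_succ]
    refine (norm_add_le _ _).trans (add_le_add ?_ ?_)
    · exact norm_convex_combination_le (h.nonneg hsk i) (h.row_sum hsk i) ih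
    · exact Finset.single_le_sum
        (f := fun i => ‖x (s + k + 1) i - ∑ l, W (s + k) i l • x (s + k) l‖)
        (fun _ _ => norm_nonneg _) (Finset.mem_univ i)

/-- The disagreement under mixing is summable up to the perturbations. -/
theorem sum_disagreement_le (hn : 0 < n) (h : MixingNetwork G W w B) {R : ℝ}
    (x : ℕ → Fin n → Vec p) (hx : ∀ k i, ‖x (k + 1) i‖ ≤ R) (T : ℕ) :
    ∑ k ∈ Finset.range T, disagreement (x (k + 1)) ≤
      (n ^ 2 / w ^ (n * B)) * (n * B * (2 * R) + 2 * (n * B) *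
        ∑ k ∈ Finset.range T, perturbation (W (k + 1)) (x (k + 1)) (x (k + 2))) := by
  have : Nonempty (Fin n) := ⟨⟨0, hn⟩⟩
  set D : ℕ → ℝ := fun k => Finset.univ.sup' Finset.univ_nonempty
    (fun ij : Fin n × Fin n => ‖x (k + 1) ij.1 - x (k + 1) ij.2‖) with hD
  have hle : ∀ k i j, ‖x (k + 1) i - x (k + 1) j‖ ≤ D k := fun k i j =>
    Finset.le_sup' (fun ij : Fin n × Fin n => ‖x (k + 1) ij.1 - x (k + 1) ij.2‖)
      (Finset.mem_univ (i, j))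
  have hD₀ : ∀ k, 0 ≤ D k := fun k =>
    (norm_nonneg _).trans (hle k ⟨0, hn⟩ ⟨0, hn⟩)
  have hwp : 0 < w ^ (n * B) := pow_pos h.w_pos _
  -- D is the diameter of the agents' decisions. It contracts over n windows of B rounds; c = 2
  -- because both agents of a pair accumulate perturbations.
  have key := sum_le_of_delayed_contraction (a := D)
    (e := fun k => perturbation (W (k + 1)) (x (k + 1)) (x (k + 2))) (N := n * B)
    (ρ := 1 - w ^ (n * B)) (M := 2 * R) (c := 2)
    (by have := pow_le_one₀ (n := n * B) h.w_pos.le h.w_lt_one.le; linarith) (by norm_num) hD₀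
    (fun k => Finset.sum_nonneg fun i _ => norm_nonneg _)
    (fun k => Finset.sup'_le _ _ fun ij _ =>
      (norm_sub_le _ _).trans (by have := hx k ij.1; have := hx k ij.2; linarith))
    (fun k => by
      refine Finset.sup'_le _ _ fun ij _ => ?_
      obtain ⟨i, j⟩ := ij
      have hi := norm_sub_transition_le h x (s := k + 1) (by omega) (n * B) i
      have hj := norm_sub_transition_le h x (s := k + 1) (by omega) (n * B) j
      have hm := h.transition_mem (s := k + 1) (by omega) (n * B)
      have hij := norm_rows_sub_le (y := x (k + 1)) (D := D k) hn hwp.le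
        (fun l => h.pow_le_transition (s := k + 1) (by omega) i l)
        (fun l => h.pow_le_transition (s := k + 1) (by omega) j l)
        (sum_row_of_mem_doublyStochastic hm i) (sum_row_of_mem_doublyStochastic hm j) (hle k)
      have e : n * B + k + 1 = k + 1 + n * B := by ring
      simp only [e]
      have e' : ∀ l, k + 1 + l = k + l + 1 := fun l => by ring
      simp only [e' _] at hi hj ⊢
      set P := ∑ l ∈ Finset.range (n * B),
        perturbation (W (k + l + 1)) (x (k + l + 1)) (x (k + l + 2))
      have tri : ∀ a b c d : Vec p, ‖a - b‖ ≤ ‖a - c‖ + ‖b - d‖ + ‖c - d‖ := fun a b c d => by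
        calc ‖a - b‖ = ‖(a - c) - (b - d) + (c - d)‖ := by congr 1; abel
          _ ≤ _ := (norm_add_le _ _).trans (add_le_add_left (norm_sub_le _ _) _)
      have := tri (x (k + n * B + 1) i) (x (k + n * B + 1) j) _ _ |>.trans
        (add_le_add (add_le_add hi hj) hij)
      refine this.trans (le_of_eq ?_)
      simp only [P]
      ring) T
  have h1 : ∑ k ∈ Finset.range T, disagreement (x (k + 1)) ≤
      n ^ 2 * ∑ k ∈ Finset.range T, D k := by
    rw [Finset.mul_sum]
    refine Finset.sum_le_sum fun k _ => ?_
    calc disagreement (x (k + 1)) ≤ ∑ _i : Fin n, ∑ _j : Fin n, D k :=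
          Finset.sum_le_sum fun i _ => Finset.sum_le_sum fun j _ => hle k i j
      _ = n ^ 2 * D k := by simp; ring
  refine h1.trans ?_
  rw [div_mul_eq_mul_div, le_div_iff₀ hwp, mul_assoc]
  refine mul_le_mul_of_nonneg_left ?_ (by positivity)
  rw [sub_sub_cancel] at key
  push_cast at key
  linarith

end Consensus

/-! ### Projection, subgradients and the primal step -/

/-- The variational inequality of the projection onto a convex set. -/
theorem IsProjection.inner_nonpos {d : ℕ} {K : Set (Vec d)} {v x : Vec d} (h : IsProjection K v x)
    (hK : Convex ℝ K) {y : Vec d} (hy : y ∈ K) : inner ℝ (v - x) (y - x) ≤ 0 := by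
  obtain ⟨hx, hmin⟩ := h
  refine (norm_eq_iInf_iff_real_inner_le_zero hK hx).mp ?_ y hy
  have : Nonempty K := ⟨⟨x, hx⟩⟩
  refine le_antisymm (le_ciInf fun z => ?_) (ciInf_le ⟨0, ?_⟩ (⟨x, hx⟩ : K))
  · have h2 : ‖v - x‖ ^ 2 ≤ ‖v - z‖ ^ 2 := hmin z.2
    exact (sq_le_sq₀ (norm_nonneg _) (norm_nonneg _)).mp h2
  · rintro _ ⟨z, rfl⟩
    exact norm_nonneg _

/-- The optimality of a projected step of size `a` in direction `-ω`. -/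
theorem IsProjection.inner_step_le {d : ℕ} {K : Set (Vec d)} {z ω x : Vec d} {a : ℝ} (ha : 0 < a)
    (h : IsProjection K (z - a • ω) x) (hK : Convex ℝ K) {y : Vec d} (hy : y ∈ K) :
    inner ℝ ω (x - y) ≤ 1 / (2 * a) * (‖z - y‖ ^ 2 - ‖x - y‖ ^ 2 - ‖x - z‖ ^ 2) := by
  have h1 := h.inner_nonpos hK hy
  have e : ‖z - y‖ ^ 2 = ‖x - y‖ ^ 2 - 2 * inner ℝ (x - y) (x - z) + ‖x - z‖ ^ 2 := by
    rw [← norm_sub_sq_real, show x - y - (x - z) = z - y by abel]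
  have e2 : inner ℝ (z - a • ω - x) (y - x) =
      inner ℝ (x - y) (x - z) + a * inner ℝ ω (x - y) := by
    rw [show z - a • ω - x = -(x - z) - a • ω by abel, show y - x = -(x - y) by abel,
      inner_sub_left, inner_neg_neg, inner_smul_left, inner_neg_right, real_inner_comm]
    simp
  rw [e2] at h1
  rw [e, div_mul_eq_mul_div, le_div_iff₀ (by positivity)]
  linarith

theorem norm_sq_convex_combination_sub_le {n d : ℕ} {c : Fin n → ℝ} {x : Fin n → Vec d}
    (hc : ∀ i, 0 ≤ c i) (hsum : ∑ i, c i = 1) (y : Vec d) :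
    ‖∑ i, c i • x i - y‖ ^ 2 ≤ ∑ i, c i * ‖x i - y‖ ^ 2 := by
  have hconv : ConvexOn ℝ Set.univ fun v : Vec d => ‖v‖ ^ 2 :=
    convexOn_univ_norm.pow (fun _ _ => norm_nonneg _) 2
  have := hconv.map_sum_le (t := Finset.univ) (w := c) (p := fun i => x i - y)
    (fun i _ => hc i) hsum (fun i _ => Set.mem_univ _)
  have e : ∑ i, c i • (x i - y) = ∑ i, c i • x i - y := by
    simp only [smul_sub, Finset.sum_sub_distrib]
    rw [← Finset.sum_smul, hsum, one_smul]
  rw [← e]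
  simpa using this

theorem inner_toEuclideanLin {p m : ℕ} (D : Matrix (Fin p) (Fin m) ℝ) (q : Vec m) (d : Vec p) :
    inner ℝ (Matrix.toEuclideanLin D q) d =
      ∑ l, q l * (Matrix.toEuclideanLin D.transpose d) l := by
  simp only [Matrix.toEuclideanLin, PiLp.inner_apply, Matrix.toLpLin_apply, Matrix.mulVec,
    dotProduct, Matrix.transpose_apply, Finset.mul_sum]
  simp only [RCLike.inner_apply, conj_trivial, Finset.mul_sum]
  rw [Finset.sum_comm]
  refine Finset.sum_congr rfl fun l _ => Finset.sum_congr rfl fun k _ => ?_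
  ring

theorem norm_col_le {p m : ℕ} (D : Matrix (Fin p) (Fin m) ℝ) (l : Fin m) :
    ‖(WithLp.toLp 2 (D.col l) : Vec p)‖ ≤ ‖D‖ := by
  have h := Matrix.l2_opNorm_mulVec D (EuclideanSpace.single l (1 : ℝ))
  simpa using h

namespace OnlineProblem

variable {n p : ℕ} {m : Fin n → ℕ}

/-- The positive part of a local constraint. -/
noncomputable def violation (P : OnlineProblem n p m) (i : Fin n) (t : ℕ) (x : Vec p)
    (l : Fin (m i)) : ℝ := max (P.g i t x l) 0

/-- The linearised change of the clipped local constraint at `x` in direction `d`. -/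
noncomputable def slope (P : OnlineProblem n p m) (i : Fin n) (t : ℕ) (x d : Vec p)
    (l : Fin (m i)) : ℝ := Matrix.toEuclideanLin (P.dgClip i t x).transpose d l

theorem slope_eq (P : OnlineProblem n p m) (i : Fin n) (t : ℕ) (x d : Vec p) (l : Fin (m i)) :
    P.slope i t x d l =
      if P.g i t x l < 0 then 0 else inner ℝ (WithLp.toLp 2 ((P.dg i t x).col l)) d := by
  simp only [slope, Matrix.toEuclideanLin, Matrix.toLpLin_apply, Matrix.mulVec, dotProduct,
    Matrix.transpose_apply, dgClip, Matrix.of_apply, PiLp.inner_apply, RCLike.inner_apply,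
    conj_trivial, Matrix.col_apply]
  split_ifs
  · simp
  · exact Finset.sum_congr rfl fun k _ => mul_comm _ _

theorem violation_nonneg (P : OnlineProblem n p m) (i : Fin n) (t : ℕ) (x : Vec p)
    (l : Fin (m i)) : 0 ≤ P.violation i t x l := le_max_right _ _

theorem slope_add (P : OnlineProblem n p m) (i : Fin n) (t : ℕ) (x d d' : Vec p)
    (l : Fin (m i)) : P.slope i t x (d + d') l = P.slope i t x d l + P.slope i t x d' l := by
  simp [slope]

namespace Regular

variable {P : OnlineProblem n p m} {R F₁ F₂ : ℝ}

theorem abs_slope_le (h : P.Regular R F₁ F₂) (i : Fin n) {t : ℕ} (ht : 1 ≤ t) {x : Vec p}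
    (hx : x ∈ P.X) (d : Vec p) (l : Fin (m i)) : |P.slope i t x d l| ≤ F₂ * ‖d‖ := by
  have hF := h.bound_dg i t ht x hx
  have hF₂ : 0 ≤ F₂ := (norm_nonneg _).trans hF
  rw [slope_eq]
  split_ifs
  · simpa using by positivity
  · refine (abs_real_inner_le_norm _ _).trans ?_
    gcongr
    exact (norm_col_le _ _).trans hF

theorem violation_le (h : P.Regular R F₁ F₂) (i : Fin n) {t : ℕ} (ht : 1 ≤ t) {x : Vec p}
    (hx : x ∈ P.X) (l : Fin (m i)) : P.violation i t x l ≤ F₁ := by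
  have h1 := h.bound_g i t ht x hx
  refine max_le ?_ ((norm_nonneg _).trans h1)
  exact (le_abs_self _).trans ((PiLp.norm_apply_le (P.g i t x) l).trans h1)

/-- Zeroing the columns of negative components yields subgradients of the positive part, the form
needed for a feasible comparator. -/
theorem violation_add_slope_le (h : P.Regular R F₁ F₂) (i : Fin n) {t : ℕ} (ht : 1 ≤ t)
    {x y : Vec p} (hx : x ∈ P.X) (hy : y ∈ P.X) (l : Fin (m i)) :
    P.violation i t x l + P.slope i t x (y - x) l ≤ P.violation i t y l := by
  rw [slope_eq, violation, violation]
  split_ifs with hg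
  · rw [max_eq_right hg.le, add_zero]
    exact le_max_right _ _
  · rw [max_eq_left (not_lt.mp hg)]
    exact (h.subgradient_g i t ht x hx l y hy).trans (le_max_left _ _)

theorem violation_le_add (h : P.Regular R F₁ F₂) (i : Fin n) {t : ℕ} (ht : 1 ≤ t)
    {x y : Vec p} (hx : x ∈ P.X) (hy : y ∈ P.X) (l : Fin (m i)) :
    P.violation i t x l ≤ P.violation i t y l + F₂ * ‖x - y‖ := by
  have h1 := h.violation_add_slope_le i ht hx hy l
  have h2 := h.abs_slope_le i ht hx (y - x) l
  rw [norm_sub_rev] at h2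
  have := neg_abs_le (P.slope i t x (y - x) l)
  linarith

theorem f_sub_le (h : P.Regular R F₁ F₂) (i : Fin n) {t : ℕ} (ht : 1 ≤ t)
    {x y : Vec p} (hx : x ∈ P.X) (hy : y ∈ P.X) :
    P.f i t x - P.f i t y ≤ F₂ * ‖x - y‖ := by
  have h1 := h.subgradient_f i t ht x hx y hy
  have h2 := (abs_real_inner_le_norm (P.df i t x) (y - x)).trans
    (mul_le_mul_of_nonneg_right (h.bound_df i t ht x hx) (norm_nonneg _))
  have h3 := neg_abs_le (inner ℝ (P.df i t x) (y - x))
  rw [norm_sub_rev] at h2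
  linarith

end Regular

theorem Feasible.violation_eq_zero {P : OnlineProblem n p m} {t : ℕ} {y : Vec p}
    (h : P.Feasible t y) (i : Fin n) (l : Fin (m i)) : P.violation i t y l = 0 :=
  max_eq_right (h.2 ⟨i, l⟩)

/-- A run of the algorithm with the theorem's stepsizes under the standing assumptions. -/
structure PowerRun (P : OnlineProblem n p m) (G : ℕ → Digraph (Fin n))
    (W : ℕ → Matrix (Fin n) (Fin n) ℝ) (κ R F₁ F₂ w : ℝ) (B : ℕ) (α₀ : ℝ)
    (x : ℕ → Fin n → Vec p) (q : ℕ → (i : Fin n) → Vec (m i)) : Prop where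
  card_pos : 0 < n
  kappa_pos : 0 < κ
  kappa_lt_one : κ < 1
  regular : P.Regular R F₁ F₂
  network : MixingNetwork G W w B
  alpha_pos : 0 < α₀
  run : P.IsRun W (fun t => α₀ / (t : ℝ) ^ κ) (fun t => 1 / (t : ℝ) ^ κ)
    (fun t => 1 / (t : ℝ) ^ (1 - κ)) x q

namespace PowerRun

variable {P : OnlineProblem n p m} {G : ℕ → Digraph (Fin n)}
  {W : ℕ → Matrix (Fin n) (Fin n) ℝ} {κ R F₁ F₂ w : ℝ} {B : ℕ} {α₀ : ℝ}
  {x : ℕ → Fin n → Vec p} {q : ℕ → (i : Fin n) → Vec (m i)}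

theorem mem (h : P.PowerRun G W κ R F₁ F₂ w B α₀ x q) (k : ℕ) (i : Fin n) :
    x (k + 1) i ∈ P.X := by
  cases k with
  | zero => exact h.run.init_x i
  | succ k => exact (h.run.step_x (k + 1) (by omega) i).1

theorem norm_le (h : P.PowerRun G W κ R F₁ F₂ w B α₀ x q) {y : Vec p} (hy : y ∈ P.X) :
    ‖y‖ ≤ R := by
  simpa using h.regular.subset_ball hy

theorem norm_sub_le_two_mul (h : P.PowerRun G W κ R F₁ F₂ w B α₀ x q) {y z : Vec p}
    (hy : y ∈ P.X) (hz : z ∈ P.X) : ‖y - z‖ ≤ 2 * R :=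
  (norm_sub_le _ _).trans (by have := h.norm_le hy; have := h.norm_le hz; linarith)

theorem R_nonneg (h : P.PowerRun G W κ R F₁ F₂ w B α₀ x q) : 0 ≤ R :=
  (norm_nonneg _).trans (h.norm_le (h.mem 0 ⟨0, h.card_pos⟩))

theorem F₁_nonneg (h : P.PowerRun G W κ R F₁ F₂ w B α₀ x q) : 0 ≤ F₁ :=
  (norm_nonneg _).trans
    (h.regular.bound_g ⟨0, h.card_pos⟩ 1 le_rfl _ (h.mem 0 ⟨0, h.card_pos⟩))

theorem F₂_nonneg (h : P.PowerRun G W κ R F₁ F₂ w B α₀ x q) : 0 ≤ F₂ :=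
  (norm_nonneg _).trans
    (h.regular.bound_df ⟨0, h.card_pos⟩ 1 le_rfl _ (h.mem 0 ⟨0, h.card_pos⟩))

/-- The product βγ is 1/t because the two exponents add up to one. Index k stands for round k + 1.
-/
theorem dualRecursion (h : P.PowerRun G W κ R F₁ F₂ w B α₀ x q) (i : Fin n) (l : Fin (m i)) :
    DualRecursion κ F₁ (F₂ * (2 * R)) (fun t => q t i l)
      (fun k => P.violation i (k + 1) (x (k + 1) i) l)
      (fun k => P.slope i (k + 1) (x (k + 1) i) (x (k + 2) i - x (k + 1) i) l) where
  kappa_pos := h.kappa_pos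
  kappa_lt_one := h.kappa_lt_one
  init := by simp [h.run.init_q]
  nonneg k := P.violation_nonneg _ _ _ _
  le k := h.regular.violation_le i (by omega) (h.mem k i) l
  abs_le k := (h.regular.abs_slope_le i (by omega) (h.mem k i) _ l).trans
    (mul_le_mul_of_nonneg_left (h.norm_sub_le_two_mul (h.mem (k + 1) i) (h.mem k i))
      h.F₂_nonneg)
  step k := by
    have h1 := congrArg (fun v : Vec (m i) => v l) (h.run.step_q (k + 1) (by omega) i)
    have hk : (0 : ℝ) < (k : ℝ) + 2 := by positivity
    have e : 1 / ((k : ℝ) + 2) ^ κ * (1 / ((k : ℝ) + 2) ^ (1 - κ)) = 1 / ((k : ℝ) + 2) := by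
      rw [one_div_mul_one_div, ← Real.rpow_add hk]
      simp
    have e2 : (((k + 1 + 1 : ℕ) : ℝ)) = (k : ℝ) + 2 := by push_cast; ring
    simp only [e2, e] at h1
    exact h1

/-- The primal optimality inequality of one agent in one round. -/
theorem local_step (h : P.PowerRun G W κ R F₁ F₂ w B α₀ x q) (k : ℕ) (i : Fin n) {y : Vec p}
    (hy : P.Feasible (k + 1) y) :
    P.f i (k + 1) (x (k + 1) i) - P.f i (k + 1) y +
      ∑ l, q (k + 1) i l * (P.violation i (k + 1) (x (k + 1) i) l +
        P.slope i (k + 1) (x (k + 1) i) (x (k + 2) i - x (k + 1) i) l) ≤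
      ((k : ℝ) + 2) ^ κ / (2 * α₀) * (‖∑ j, W (k + 1) i j • x (k + 1) j - y‖ ^ 2 -
        ‖x (k + 2) i - y‖ ^ 2 - ‖x (k + 2) i - ∑ j, W (k + 1) i j • x (k + 1) j‖ ^ 2) +
      F₂ * ‖x (k + 2) i - x (k + 1) i‖ := by
  have hx := h.mem k i
  have hk1 : 1 ≤ k + 1 := by omega
  have hα := h.alpha_pos
  have e2 : (((k + 1 + 1 : ℕ) : ℝ)) = (k : ℝ) + 2 := by push_cast; ring
  have hstep := (h.run.step_x (k + 1) hk1 i).inner_step_le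
    (by rw [e2]; positivity) h.regular.convex hy.1
  rw [e2, show 1 / (2 * (α₀ / ((k : ℝ) + 2) ^ κ)) = ((k : ℝ) + 2) ^ κ / (2 * α₀) by
    field_simp, inner_add_left, inner_toEuclideanLin] at hstep
  refine le_trans ?_ (add_le_add_left hstep _)
  have h1 := h.regular.subgradient_f i (k + 1) hk1 _ hx y hy.1
  have h2 : inner ℝ (P.df i (k + 1) (x (k + 1) i)) (x (k + 1 + 1) i - y) =
      -inner ℝ (P.df i (k + 1) (x (k + 1) i)) (y - x (k + 1) i) +
        inner ℝ (P.df i (k + 1) (x (k + 1) i)) (x (k + 2) i - x (k + 1) i) := by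
    rw [← inner_neg_right, ← inner_add_right]
    congr 1
    change x (k + 2) i - y = _
    abel
  have h3 : -(F₂ * ‖x (k + 2) i - x (k + 1) i‖) ≤
      inner ℝ (P.df i (k + 1) (x (k + 1) i)) (x (k + 2) i - x (k + 1) i) := by
    have := (abs_real_inner_le_norm (P.df i (k + 1) (x (k + 1) i))
      (x (k + 2) i - x (k + 1) i)).trans
      (mul_le_mul_of_nonneg_right (h.regular.bound_df i _ hk1 _ hx) (norm_nonneg _))
    have h4 := neg_abs_le (inner ℝ (P.df i (k + 1) (x (k + 1) i)) (x (k + 2) i - x (k + 1) i))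
    linarith
  -- The violation vanishes at y, so u plus the slope towards y is nonpositive; q ≥ 0 preserves
  -- this.
  have h4 : ∑ l, q (k + 1) i l * (P.violation i (k + 1) (x (k + 1) i) l +
        P.slope i (k + 1) (x (k + 1) i) (x (k + 2) i - x (k + 1) i) l) ≤
      ∑ l, q (k + 1) i l * P.slope i (k + 1) (x (k + 1) i) (x (k + 2) i - y) l := by
    refine Finset.sum_le_sum fun l _ => ?_
    refine mul_le_mul_of_nonneg_left ?_ ((h.dualRecursion i l).q_nonneg k)
    have h5 := h.regular.violation_add_slope_le i hk1 hx hy.1 l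
    rw [hy.violation_eq_zero] at h5
    have h6 := P.slope_add i (k + 1) (x (k + 1) i) (x (k + 2) i - y) (y - x (k + 1) i) l
    rw [sub_add_sub_cancel] at h6
    linarith
  rw [h2]
  change _ ≤ _ + ∑ l, q (k + 1) i l * P.slope i (k + 1) (x (k + 1) i) (x (k + 2) i - y) l + _
  linarith

/-- The primal optimality inequality of one round, summed over the agents. -/
theorem network_step (h : P.PowerRun G W κ R F₁ F₂ w B α₀ x q) (k : ℕ) {y : Vec p}
    (hy : P.Feasible (k + 1) y) :
    ∑ i, (P.f i (k + 1) (x (k + 1) i) - P.f i (k + 1) y) +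
      ∑ i, ∑ l, q (k + 1) i l * (P.violation i (k + 1) (x (k + 1) i) l +
        P.slope i (k + 1) (x (k + 1) i) (x (k + 2) i - x (k + 1) i) l) +
      ((k : ℝ) + 2) ^ κ / (2 * α₀) *
        ∑ i, ‖x (k + 2) i - ∑ j, W (k + 1) i j • x (k + 1) j‖ ^ 2 ≤
      ((k : ℝ) + 2) ^ κ / (2 * α₀) *
        (∑ i, ‖x (k + 1) i - y‖ ^ 2 - ∑ i, ‖x (k + 2) i - y‖ ^ 2) +
      F₂ * ∑ i, ‖x (k + 2) i - x (k + 1) i‖ := by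
  have hα := h.alpha_pos
  have hk1 : 1 ≤ k + 1 := by omega
  -- Jensen uses the unit row sums, and exchanging the sums uses the unit column sums.
  have hmix : ∑ i, ‖∑ j, W (k + 1) i j • x (k + 1) j - y‖ ^ 2 ≤ ∑ i, ‖x (k + 1) i - y‖ ^ 2 := by
    calc _ ≤ ∑ i, ∑ j, W (k + 1) i j * ‖x (k + 1) j - y‖ ^ 2 :=
          Finset.sum_le_sum fun i _ => norm_sq_convex_combination_sub_le
            (h.network.nonneg hk1 i) (h.network.row_sum hk1 i) y
      _ = ∑ j, (∑ i, W (k + 1) i j) * ‖x (k + 1) j - y‖ ^ 2 := by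
          rw [Finset.sum_comm]
          simp only [Finset.sum_mul]
      _ = _ := by simp only [h.network.col_sum hk1, one_mul]
  have hsum := Finset.sum_le_sum fun i (_ : i ∈ Finset.univ) => h.local_step k i hy
  simp only [Finset.sum_add_distrib, ← Finset.mul_sum] at hsum ⊢
  simp only [Finset.sum_sub_distrib] at hsum ⊢
  have h0 : (0 : ℝ) ≤ ((k : ℝ) + 2) ^ κ / (2 * α₀) := by positivity
  have := mul_le_mul_of_nonneg_left hmix h0
  simp only [mul_sub] at hsum ⊢
  simp only [mul_add, Finset.sum_add_distrib] at hsum ⊢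
  linarith

end PowerRun

end OnlineProblem

/-! ### Movement, dual drift and the joint energy bound -/

namespace OnlineProblem.PowerRun

variable {n p : ℕ} {m : Fin n → ℕ} {P : OnlineProblem n p m} {G : ℕ → Digraph (Fin n)}
  {W : ℕ → Matrix (Fin n) (Fin n) ℝ} {κ R F₁ F₂ w : ℝ} {B : ℕ} {α₀ : ℝ}
  {x : ℕ → Fin n → Vec p} {q : ℕ → (i : Fin n) → Vec (m i)}

theorem sum_norm_move_le (h : P.PowerRun G W κ R F₁ F₂ w B α₀ x q) (k : ℕ) :
    ∑ i, ‖x (k + 2) i - x (k + 1) i‖ ≤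
      perturbation (W (k + 1)) (x (k + 1)) (x (k + 2)) + disagreement (x (k + 1)) := by
  have hk1 : 1 ≤ k + 1 := by omega
  rw [perturbation, disagreement, ← Finset.sum_add_distrib]
  refine Finset.sum_le_sum fun i _ => ?_
  refine (norm_sub_le_norm_sub_add_norm_sub _ (∑ j, W (k + 1) i j • x (k + 1) j) _).trans
    (add_le_add_right ?_ _)
  have e : ∑ j, W (k + 1) i j • x (k + 1) j - x (k + 1) i =
      ∑ j, W (k + 1) i j • (x (k + 1) j - x (k + 1) i) := by
    simp only [smul_sub, Finset.sum_sub_distrib]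
    rw [← Finset.sum_smul, h.network.row_sum hk1, one_smul]
  rw [e]
  refine (norm_sum_le _ _).trans (Finset.sum_le_sum fun j _ => ?_)
  rw [norm_smul, Real.norm_of_nonneg (h.network.nonneg hk1 i j), norm_sub_rev]
  exact mul_le_of_le_one_left (norm_nonneg _) (h.network.le_one hk1 i j)

theorem sum_abs_slope_le (h : P.PowerRun G W κ R F₁ F₂ w B α₀ x q) (k : ℕ) :
    ∑ i, ∑ l, |P.slope i (k + 1) (x (k + 1) i) (x (k + 2) i - x (k + 1) i) l| ≤
      (∑ i, (m i : ℝ)) * F₂ * ∑ i, ‖x (k + 2) i - x (k + 1) i‖ := by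
  rw [Finset.mul_sum]
  refine Finset.sum_le_sum fun i _ => ?_
  have hF := h.F₂_nonneg
  calc _ ≤ ∑ _l : Fin (m i), F₂ * ‖x (k + 2) i - x (k + 1) i‖ :=
        Finset.sum_le_sum fun l _ => h.regular.abs_slope_le i (by omega) (h.mem k i) _ l
    _ = (m i : ℝ) * (F₂ * ‖x (k + 2) i - x (k + 1) i‖) := by simp
    _ ≤ (∑ i, (m i : ℝ)) * (F₂ * ‖x (k + 2) i - x (k + 1) i‖) := by
        refine mul_le_mul_of_nonneg_right ?_ (by positivity)
        exact Finset.single_le_sum (f := fun i => (m i : ℝ)) (fun _ _ => by positivity)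
          (Finset.mem_univ i)
    _ = _ := by ring

/-- The total squared excess of the dual variables over `F₁`. -/
noncomputable def _root_.dualExcess (F₁ : ℝ) (q : (i : Fin n) → Vec (m i)) : ℝ :=
  ∑ i, ∑ l, max (q i l - F₁) 0 ^ 2

theorem dualExcess_le (h : P.PowerRun G W κ R F₁ F₂ w B α₀ x q) (T : ℕ) :
    1 / 2 * (dualExcess F₁ (q (T + 1)) * ((T : ℝ) + 1) ^ (1 - κ)) ≤
      ∑ k ∈ Finset.range T, ∑ i, ∑ l, q (k + 1) i l *
        (P.violation i (k + 1) (x (k + 1) i) l +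
          P.slope i (k + 1) (x (k + 1) i) (x (k + 2) i - x (k + 1) i) l) +
      2 * (F₁ + F₂ * (2 * R)) * ∑ k ∈ Finset.range T, ∑ i, ∑ l,
        |P.slope i (k + 1) (x (k + 1) i) (x (k + 2) i - x (k + 1) i) l| := by
  have h1 := Finset.sum_le_sum fun i (_ : i ∈ Finset.univ) =>
    Finset.sum_le_sum fun l (_ : l ∈ Finset.univ) => (h.dualRecursion i l).excess_sq_le T
  simp only [Finset.sum_add_distrib, ← Finset.mul_sum, ← Finset.sum_mul] at h1
  rw [dualExcess]
  refine h1.trans (le_of_eq ?_)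
  congr 1
  · rw [Finset.sum_comm' (t' := Finset.univ) (s' := fun _ => Finset.range T) (by simp)]
    exact Finset.sum_congr rfl fun i _ => Finset.sum_comm
  · congr 1
    rw [Finset.sum_comm' (t' := Finset.univ) (s' := fun _ => Finset.range T) (by simp)]
    exact Finset.sum_congr rfl fun i _ => Finset.sum_comm

/-- The comparator distances telescope up to the path length. -/
theorem sum_distance_le (h : P.PowerRun G W κ R F₁ F₂ w B α₀ x q) {T : ℕ} (hT : 1 ≤ T)
    {y : ℕ → Vec p} (hy : P.FeasibleSeq T y) :
    ∑ k ∈ Finset.range T, ((k : ℝ) + 2) ^ κ / (2 * α₀) *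
        (∑ i, ‖x (k + 1) i - y (k + 1)‖ ^ 2 - ∑ i, ‖x (k + 2) i - y (k + 1)‖ ^ 2) ≤
      4 * n * R * (1 + R) * ((T : ℝ) ^ κ * (1 + pathLength T y) / α₀) := by
  obtain ⟨S, rfl⟩ := Nat.exists_eq_add_of_le' hT
  have hα := h.alpha_pos
  have hR := h.R_nonneg
  have hyX : ∀ k ≤ S, y (k + 1) ∈ P.X := fun k hk =>
    (hy (k + 1) (Finset.mem_Icc.mpr ⟨by omega, by omega⟩)).1
  have hsq : ∀ (k j : ℕ), j ≤ S → ∑ i, ‖x (k + 1) i - y (j + 1)‖ ^ 2 ≤ n * (2 * R) ^ 2 := by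
    intro k j hj
    calc _ ≤ ∑ _i : Fin n, (2 * R) ^ 2 := by
          gcongr with i
          exact h.norm_sub_le_two_mul (h.mem k i) (hyX j hj)
      _ = _ := by simp
  have key := weighted_telescope (h := fun k : ℕ => ((k : ℝ) + 2) ^ κ / (2 * α₀))
    (a := fun k => ∑ i, ‖x (k + 1) i - y (k + 1)‖ ^ 2)
    (b := fun k => ∑ i, ‖x (k + 2) i - y (k + 1)‖ ^ 2)
    (d := fun k => n * (4 * R) * ‖y (k + 2) - y (k + 1)‖) (M := n * (2 * R) ^ 2)
    (fun k => by positivity)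
    (fun k => by
      have := h.kappa_pos
      push_cast
      gcongr
      linarith)
    (fun k => by positivity) S (hsq 0 0 (by omega)) (fun k hk => hsq (k + 1) k hk)
    (fun k hk => by
      have e : n * (4 * R) * ‖y (k + 2) - y (k + 1)‖ =
          ∑ _i : Fin n, 4 * R * ‖y (k + 2) - y (k + 1)‖ := by simp; ring
      simp only [e]
      rw [← Finset.sum_add_distrib]
      refine Finset.sum_le_sum fun i _ => ?_
      have h1 := h.norm_sub_le_two_mul (h.mem (k + 1) i) (hyX (k + 1) (by omega))
      have h2 := h.norm_sub_le_two_mul (h.mem (k + 1) i) (hyX k (by omega))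
      have h3 := norm_sub_le_norm_sub_add_norm_sub (x (k + 2) i) (y (k + 1)) (y (k + 2))
      rw [norm_sub_rev (y (k + 1))] at h3
      have h4 := norm_nonneg (x (k + 2) i - y (k + 1))
      have h5 := norm_nonneg (x (k + 2) i - y (k + 2))
      have h6 := norm_nonneg (y (k + 2) - y (k + 1))
      change ‖x (k + 2) i - y (k + 2)‖ ^ 2 ≤ _
      change ‖x (k + 2) i - y (k + 2)‖ ≤ _ at h1
      change ‖x (k + 2) i - y (k + 1)‖ ≤ _ at h2
      nlinarith)
  refine key.trans ?_
  have hpl : pathLength (S + 1) y = ∑ k ∈ Finset.range S, ‖y (k + 2) - y (k + 1)‖ := by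
    rw [pathLength, Finset.sum_Ico_eq_sum_range]
    refine Finset.sum_congr (by simp) fun k _ => ?_
    rw [add_comm 1 k]
  have hp0 : 0 ≤ pathLength (S + 1) y := Finset.sum_nonneg fun _ _ => norm_nonneg _
  rw [← Finset.mul_sum, ← hpl]
  have h2 : ((S : ℝ) + 2) ^ κ ≤ 2 * ((S : ℝ) + 1) ^ κ := by
    have := rpow_succ_le_two_mul h.kappa_pos.le h.kappa_lt_one.le
      (t := (S : ℝ) + 1) (by linarith [Nat.cast_nonneg (α := ℝ) S])
    rwa [show (S : ℝ) + 1 + 1 = S + 2 by ring] at this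
  have hb : 0 ≤ ∑ i, ‖x (S + 2) i - y (S + 1)‖ ^ 2 := Finset.sum_nonneg fun _ _ => by positivity
  push_cast
  calc ((S : ℝ) + 2) ^ κ / (2 * α₀) * (n * (2 * R) ^ 2 + n * (4 * R) * pathLength (S + 1) y -
        ∑ i, ‖x (S + 2) i - y (S + 1)‖ ^ 2)
      ≤ ((S : ℝ) + 2) ^ κ / (2 * α₀) *
        (4 * n * R * (1 + R) * (1 + pathLength (S + 1) y)) := by
        refine mul_le_mul_of_nonneg_left ?_ (by positivity)
        have h7 : 0 ≤ (n : ℝ) * R * (1 + R * pathLength (S + 1) y) := by positivity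
        nlinarith
    _ ≤ (2 * ((S : ℝ) + 1) ^ κ) / (2 * α₀) *
        (4 * n * R * (1 + R) * (1 + pathLength (S + 1) y)) := by gcongr
    _ = _ := by field_simp

/-- Young's inequality at the scale of the stepsize α₀/(k+2)^κ. Its quadratic part is half of what
the projection provides; c is left free for two different uses. -/
theorem mul_perturbation_le (h : P.PowerRun G W κ R F₁ F₂ w B α₀ x q) (c : ℝ) (k : ℕ) :
    c * perturbation (W (k + 1)) (x (k + 1)) (x (k + 2)) ≤
      n * c ^ 2 * (α₀ * (1 / ((k : ℝ) + 1) ^ κ)) + ((k : ℝ) + 2) ^ κ / (4 * α₀) *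
        ∑ i, ‖x (k + 2) i - ∑ j, W (k + 1) i j • x (k + 1) j‖ ^ 2 := by
  have hα := h.alpha_pos
  have hκ := h.kappa_pos
  have e : n * c ^ 2 * (α₀ * (1 / ((k : ℝ) + 1) ^ κ)) =
      ∑ _i : Fin n, c ^ 2 * (α₀ * (1 / ((k : ℝ) + 1) ^ κ)) := by simp; ring
  rw [perturbation, Finset.mul_sum, Finset.mul_sum, e, ← Finset.sum_add_distrib]
  refine Finset.sum_le_sum fun i _ => ?_
  set ε := ‖x (k + 2) i - ∑ j, W (k + 1) i j • x (k + 1) j‖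
  set a := α₀ / ((k : ℝ) + 2) ^ κ with ha
  have ha0 : 0 < a := by positivity
  have e1 : ((k : ℝ) + 2) ^ κ / (4 * α₀) = 1 / (4 * a) := by rw [ha]; field_simp
  have e2 : a ≤ α₀ * (1 / ((k : ℝ) + 1) ^ κ) := by
    rw [ha, mul_one_div]
    gcongr
    norm_num
  rw [e1]
  refine le_trans ?_ (add_le_add_left (mul_le_mul_of_nonneg_left e2 (sq_nonneg c)) _)
  have e3 : c ^ 2 * a + 1 / (4 * a) * ε ^ 2 - c * ε = (2 * c * a - ε) ^ 2 / (4 * a) := by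
    field_simp; ring
  have : 0 ≤ (2 * c * a - ε) ^ 2 / (4 * a) := by positivity
  linarith

/-- The joint energy bound for the local regret, the dual excess, the perturbations and the
disagreement. -/
theorem energy_le (n : ℕ) (m : Fin n → ℕ) (κ R F₁ F₂ w : ℝ) (B : ℕ) :
    ∃ C : ℝ, 0 ≤ C ∧ ∀ {p : ℕ} {P : OnlineProblem n p m} {G : ℕ → Digraph (Fin n)}
      {W : ℕ → Matrix (Fin n) (Fin n) ℝ} {α₀ : ℝ} {x : ℕ → Fin n → Vec p}
      {q : ℕ → (i : Fin n) → Vec (m i)}, P.PowerRun G W κ R F₁ F₂ w B α₀ x q →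
      ∀ {T : ℕ}, 1 ≤ T → ∀ {y : ℕ → Vec p}, P.FeasibleSeq T y →
        ∑ k ∈ Finset.range T, ∑ i, (P.f i (k + 1) (x (k + 1) i) - P.f i (k + 1) (y (k + 1))) +
          1 / 2 * (dualExcess F₁ (q (T + 1)) * ((T : ℝ) + 1) ^ (1 - κ)) +
          ∑ k ∈ Finset.range T, ((k : ℝ) + 2) ^ κ / (4 * α₀) *
            ∑ i, ‖x (k + 2) i - ∑ j, W (k + 1) i j • x (k + 1) j‖ ^ 2 +
          F₂ * ∑ k ∈ Finset.range T, disagreement (x (k + 1)) ≤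
        C * (α₀ * (T : ℝ) ^ (1 - κ) + (T : ℝ) ^ κ * (1 + pathLength T y) / α₀) := by
  -- K collects the coefficients of movement and disagreement: F₂ from the primal step, F₂ from the
  -- disagreement on the left, the rest from the dual errors |v|. Then c and a₀ come from inserting
  -- the disagreement bound.
  set K : ℝ := 2 * F₂ + 2 * (F₁ + F₂ * (2 * R)) * ((∑ i, (m i : ℝ)) * F₂) with hK
  set A : ℝ := n ^ 2 / w ^ (n * B) with hA
  set c : ℝ := K * (1 + A * (2 * (n * B))) with hc
  set a₀ : ℝ := K * (A * (n * B * (2 * R))) with ha₀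
  -- Absolute values, since the constants are fixed before any run certifies the signs of the
  -- parameters.
  refine ⟨|4 * n * R * (1 + R)| + |a₀| + |n * c ^ 2 / (1 - κ)|, by positivity, ?_⟩
  intro p P G W α₀ x q h T hT y hy
  have hα := h.alpha_pos
  have hκ₁ : 0 < 1 - κ := by linarith [h.kappa_lt_one]
  have hF₁ := h.F₁_nonneg
  have hF₂ := h.F₂_nonneg
  have hR := h.R_nonneg
  have hT0 : (0 : ℝ) < T := by exact_mod_cast hT
  have hT1 : (1 : ℝ) ≤ T := by exact_mod_cast hT
  have hp0 : 0 ≤ pathLength T y := Finset.sum_nonneg fun _ _ => norm_nonneg _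
  have hKm : 0 ≤ 2 * (F₁ + F₂ * (2 * R)) * ((∑ i, (m i : ℝ)) * F₂) := by
    have : 0 ≤ ∑ i, (m i : ℝ) := Finset.sum_nonneg fun _ _ => by positivity
    positivity
  have hK0 : 0 ≤ K := by positivity
  set a := α₀ * (T : ℝ) ^ (1 - κ) with ha
  set b := (T : ℝ) ^ κ * (1 + pathLength T y) / α₀ with hb
  have ha0 : 0 ≤ a := by positivity
  have hb0 : 0 ≤ b := by positivity
  -- The product ab equals T(1 + path length) ≥ 1, whatever α₀ is, so additive constants are
  -- absorbed into the rate.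
  have hab : 1 ≤ a + b := by
    have h1 : 1 ≤ a * b := by
      have e : a * b = ((T : ℝ) ^ (1 - κ) * (T : ℝ) ^ κ) * (1 + pathLength T y) := by
        rw [ha, hb]; field_simp
      rw [e, ← Real.rpow_add hT0, sub_add_cancel, Real.rpow_one]
      nlinarith
    nlinarith
  have hstep := Finset.sum_le_sum fun k (hk : k ∈ Finset.range T) =>
    h.network_step k (hy (k + 1) (by rw [Finset.mem_range] at hk; simp; omega))
  simp only [Finset.sum_add_distrib, ← Finset.mul_sum] at hstep
  have hdist := h.sum_distance_le hT hy
  have hdual := h.dualExcess_le T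
  have hslope := Finset.sum_le_sum fun k (_ : k ∈ Finset.range T) => h.sum_abs_slope_le k
  rw [← Finset.mul_sum] at hslope
  have hmove := Finset.sum_le_sum fun k (_ : k ∈ Finset.range T) => h.sum_norm_move_le k
  rw [Finset.sum_add_distrib] at hmove
  have hdis := sum_disagreement_le h.card_pos h.network x (fun k i => h.norm_le (h.mem k i)) T
  rw [← hA] at hdis
  have hyoung := Finset.sum_le_sum fun k (_ : k ∈ Finset.range T) => h.mul_perturbation_le c k
  simp only [Finset.sum_add_distrib] at hyoung
  rw [← Finset.mul_sum, ← Finset.mul_sum, ← Finset.mul_sum] at hyoung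
  have hpow := sum_inv_rpow_le h.kappa_pos h.kappa_lt_one T
  set SP := ∑ k ∈ Finset.range T, perturbation (W (k + 1)) (x (k + 1)) (x (k + 2))
  set SD := ∑ k ∈ Finset.range T, disagreement (x (k + 1))
  set SM := ∑ k ∈ Finset.range T, ∑ i, ‖x (k + 2) i - x (k + 1) i‖
  have hhalf : ∑ k ∈ Finset.range T, ((k : ℝ) + 2) ^ κ / (2 * α₀) *
      ∑ i, ‖x (k + 2) i - ∑ j, W (k + 1) i j • x (k + 1) j‖ ^ 2 =
      2 * ∑ k ∈ Finset.range T, ((k : ℝ) + 2) ^ κ / (4 * α₀) *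
        ∑ i, ‖x (k + 2) i - ∑ j, W (k + 1) i j • x (k + 1) j‖ ^ 2 := by
    rw [Finset.mul_sum]
    refine Finset.sum_congr rfl fun k _ => ?_
    field_simp
    ring
  rw [hhalf] at hstep
  set E := ∑ k ∈ Finset.range T, ((k : ℝ) + 2) ^ κ / (4 * α₀) *
        ∑ i, ‖x (k + 2) i - ∑ j, W (k + 1) i j • x (k + 1) j‖ ^ 2
  have h1 : n * c ^ 2 * (α₀ * ∑ k ∈ Finset.range T, 1 / ((k : ℝ) + 1) ^ κ) ≤
      |n * c ^ 2 / (1 - κ)| * a := by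
    calc _ ≤ n * c ^ 2 * (α₀ * ((T : ℝ) ^ (1 - κ) / (1 - κ))) := by gcongr
      _ = n * c ^ 2 / (1 - κ) * a := by rw [ha]; ring
      _ ≤ _ := mul_le_mul_of_nonneg_right (le_abs_self _) ha0
  have h2 : 4 * n * R * (1 + R) * b ≤ |4 * n * R * (1 + R)| * b :=
    mul_le_mul_of_nonneg_right (le_abs_self _) hb0
  have h3 : a₀ ≤ |a₀| * (a + b) := (le_abs_self _).trans (le_mul_of_one_le_right (abs_nonneg _) hab)
  have hSD0 : 0 ≤ SD := Finset.sum_nonneg fun k _ =>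
    Finset.sum_nonneg fun i _ => Finset.sum_nonneg fun j _ => norm_nonneg _
  have h4 : K * (SP + SD) ≤ c * SP + a₀ := by
    calc K * (SP + SD) ≤ K * (SP + A * (n * B * (2 * R) + 2 * (n * B) * SP)) := by gcongr
      _ = _ := by rw [hc, ha₀]; ring
  have hsl := mul_le_mul_of_nonneg_left hslope (by positivity : 0 ≤ 2 * (F₁ + F₂ * (2 * R)))
  have h5 : F₂ * SM + 2 * (F₁ + F₂ * (2 * R)) * ((∑ i, (m i : ℝ)) * F₂ * SM) + F₂ * SD ≤
      K * (SP + SD) := by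
    have h6 := mul_le_mul_of_nonneg_left hmove
      (by positivity : 0 ≤ F₂ + 2 * (F₁ + F₂ * (2 * R)) * ((∑ i, (m i : ℝ)) * F₂))
    have hSP0 : 0 ≤ SP := Finset.sum_nonneg fun k _ => Finset.sum_nonneg fun i _ => norm_nonneg _
    have h7 : 0 ≤ F₂ * SP := by positivity
    rw [hK]
    linarith
  have h8 : 0 ≤ |4 * n * R * (1 + R)| * a := by positivity
  have h9 : 0 ≤ |n * c ^ 2 / (1 - κ)| * b := by positivity
  linarith

end OnlineProblem.PowerRun

/-! ### Network regret and violation from local quantities -/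

theorem sum_Icc_one_eq_sum_range (T : ℕ) (F : ℕ → ℝ) :
    ∑ t ∈ Finset.Icc 1 T, F t = ∑ k ∈ Finset.range T, F (k + 1) := by
  rw [← Finset.Ico_succ_right_eq_Icc, Finset.sum_Ico_eq_sum_range]
  exact Finset.sum_congr (by simp) fun k _ => by rw [add_comm]

theorem norm_clip_le {ι : Type} [Fintype ι] (v : EuclideanSpace ℝ ι) :
    ‖clip v‖ ≤ ∑ s, max (v s) 0 := by
  classical
  have e : clip v = ∑ s, EuclideanSpace.single s (max (v s) 0) := by
    ext s
    simp [clip, Finset.sum_apply, Pi.single_apply]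
  rw [e]
  refine (norm_sum_le _ _).trans (Finset.sum_le_sum fun s _ => ?_)
  rw [PiLp.norm_single, Real.norm_of_nonneg (le_max_right _ _)]

namespace OnlineProblem.PowerRun

variable {n p : ℕ} {m : Fin n → ℕ} {P : OnlineProblem n p m} {G : ℕ → Digraph (Fin n)}
  {W : ℕ → Matrix (Fin n) (Fin n) ℝ} {κ R F₁ F₂ w : ℝ} {B : ℕ} {α₀ : ℝ}
  {x : ℕ → Fin n → Vec p} {q : ℕ → (i : Fin n) → Vec (m i)}

/-- The network regret is controlled by the local regrets and the disagreement. -/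
theorem card_mul_netReg_le (h : P.PowerRun G W κ R F₁ F₂ w B α₀ x q) (T : ℕ) {y : ℕ → Vec p} :
    n * P.netReg T x y ≤
      ∑ k ∈ Finset.range T, ∑ i, (P.f i (k + 1) (x (k + 1) i) - P.f i (k + 1) (y (k + 1))) +
        F₂ * ∑ k ∈ Finset.range T, disagreement (x (k + 1)) := by
  have hn : (0 : ℝ) < n := by exact_mod_cast h.card_pos
  have hn1 : (1 : ℝ) ≤ n := by exact_mod_cast h.card_pos
  have hF₂ := h.F₂_nonneg
  have e : n * P.netReg T x y = ∑ k ∈ Finset.range T,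
      (∑ i, P.globalLoss (k + 1) (x (k + 1) i) - n * P.globalLoss (k + 1) (y (k + 1))) := by
    rw [netReg, Finset.sum_comm, sum_Icc_one_eq_sum_range, sum_Icc_one_eq_sum_range,
      Finset.sum_sub_distrib, mul_sub, ← mul_assoc, mul_one_div_cancel hn.ne', one_mul,
      Finset.mul_sum]
  rw [e, Finset.mul_sum, ← Finset.sum_add_distrib]
  refine Finset.sum_le_sum fun k _ => ?_
  have h1 : n * P.globalLoss (k + 1) (y (k + 1)) = ∑ i, P.f i (k + 1) (y (k + 1)) := by
    rw [globalLoss, ← mul_assoc, mul_one_div_cancel hn.ne', one_mul]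
  have h2 : ∑ i, P.globalLoss (k + 1) (x (k + 1) i) ≤
      ∑ j, P.f j (k + 1) (x (k + 1) j) + F₂ * disagreement (x (k + 1)) := by
    calc ∑ i, P.globalLoss (k + 1) (x (k + 1) i)
        ≤ ∑ i, 1 / (n : ℝ) * ∑ j, (P.f j (k + 1) (x (k + 1) j) +
          F₂ * ‖x (k + 1) i - x (k + 1) j‖) := by
          refine Finset.sum_le_sum fun i _ => mul_le_mul_of_nonneg_left ?_ (by positivity)
          refine Finset.sum_le_sum fun j _ => ?_
          have := h.regular.f_sub_le j (t := k + 1) (by omega) (h.mem k i) (h.mem k j)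
          linarith
      _ = ∑ j, P.f j (k + 1) (x (k + 1) j) + 1 / (n : ℝ) * (F₂ * disagreement (x (k + 1))) := by
          simp only [Finset.sum_add_distrib, ← Finset.mul_sum, mul_add, disagreement]
          simp only [Finset.sum_const, Finset.card_univ, Fintype.card_fin, nsmul_eq_mul]
          field_simp
      _ ≤ _ := by
          have : 0 ≤ disagreement (x (k + 1)) :=
            Finset.sum_nonneg fun i _ => Finset.sum_nonneg fun j _ => norm_nonneg _
          refine add_le_add_right ?_ _
          exact mul_le_of_le_one_left (mul_nonneg hF₂ this) ((div_le_one hn).mpr hn1)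
  rw [h1, Finset.sum_sub_distrib]
  linarith

theorem norm_clip_globalConstraint_le (P : OnlineProblem n p m) (t : ℕ) (y : Vec p) :
    ‖clip (P.globalConstraint t y)‖ ≤ ∑ j, ∑ l, P.violation j t y l := by
  refine (norm_clip_le _).trans (le_of_eq ?_)
  rw [Fintype.sum_sigma]
  rfl

/-- The network violation is controlled by the local violations and the disagreement. -/
theorem netViolation_le (h : P.PowerRun G W κ R F₁ F₂ w B α₀ x q) (T : ℕ) :
    P.netViolation T x ≤
      ∑ k ∈ Finset.range T, ∑ j, ∑ l, P.violation j (k + 1) (x (k + 1) j) l +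
        (∑ i, (m i : ℝ)) * F₂ * ∑ k ∈ Finset.range T, disagreement (x (k + 1)) := by
  have hn : (0 : ℝ) < n := by exact_mod_cast h.card_pos
  have hn1 : (1 : ℝ) ≤ n := by exact_mod_cast h.card_pos
  have hF₂ := h.F₂_nonneg
  rw [netViolation, Finset.sum_comm, sum_Icc_one_eq_sum_range, Finset.mul_sum, Finset.mul_sum,
    ← Finset.sum_add_distrib]
  refine Finset.sum_le_sum fun k _ => ?_
  have hm0 : 0 ≤ ∑ i, (m i : ℝ) := Finset.sum_nonneg fun _ _ => by positivity
  have hd0 : 0 ≤ disagreement (x (k + 1)) :=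
    Finset.sum_nonneg fun i _ => Finset.sum_nonneg fun j _ => norm_nonneg _
  calc 1 / (n : ℝ) * ∑ i, ‖clip (P.globalConstraint (k + 1) (x (k + 1) i))‖
      ≤ 1 / (n : ℝ) * ∑ i, ∑ j, (∑ l, P.violation j (k + 1) (x (k + 1) j) l +
          (∑ i, (m i : ℝ)) * F₂ * ‖x (k + 1) i - x (k + 1) j‖) := by
        refine mul_le_mul_of_nonneg_left ?_ (by positivity)
        refine Finset.sum_le_sum fun i _ => ?_
        refine (norm_clip_globalConstraint_le P _ _).trans ?_
        refine Finset.sum_le_sum fun j _ => ?_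
        calc ∑ l, P.violation j (k + 1) (x (k + 1) i) l
            ≤ ∑ l, (P.violation j (k + 1) (x (k + 1) j) l +
              F₂ * ‖x (k + 1) i - x (k + 1) j‖) :=
              Finset.sum_le_sum fun l _ =>
                h.regular.violation_le_add j (by omega) (h.mem k i) (h.mem k j) l
          _ = ∑ l, P.violation j (k + 1) (x (k + 1) j) l +
              (m j : ℝ) * (F₂ * ‖x (k + 1) i - x (k + 1) j‖) := by
              rw [Finset.sum_add_distrib]; simp
          _ ≤ _ := by
              rw [mul_assoc]
              gcongr
              exact Finset.single_le_sum (f := fun i => (m i : ℝ)) (fun _ _ => by positivity)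
                (Finset.mem_univ j)
    _ = ∑ j, ∑ l, P.violation j (k + 1) (x (k + 1) j) l +
          1 / (n : ℝ) * ((∑ i, (m i : ℝ)) * F₂ * disagreement (x (k + 1))) := by
        simp only [Finset.sum_add_distrib, ← Finset.mul_sum, mul_add, disagreement]
        simp only [Finset.sum_const, Finset.card_univ, Fintype.card_fin, nsmul_eq_mul]
        field_simp
    _ ≤ _ := by
        refine add_le_add_right ?_ _
        exact mul_le_of_le_one_left (mul_nonneg (mul_nonneg hm0 hF₂) hd0)
          ((div_le_one hn).mpr hn1)

theorem netViolation_le_mul (h : P.PowerRun G W κ R F₁ F₂ w B α₀ x q) (T : ℕ) :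
    P.netViolation T x ≤ (∑ i, (m i : ℝ)) * F₁ * T := by
  have hn : (0 : ℝ) < n := by exact_mod_cast h.card_pos
  rw [netViolation, Finset.sum_comm, sum_Icc_one_eq_sum_range, Finset.mul_sum]
  calc _ ≤ ∑ _k ∈ Finset.range T, 1 / (n : ℝ) * ∑ _i : Fin n, (∑ i, (m i : ℝ)) * F₁ := by
        refine Finset.sum_le_sum fun k _ => mul_le_mul_of_nonneg_left ?_ (by positivity)
        refine Finset.sum_le_sum fun i _ => (norm_clip_globalConstraint_le P _ _).trans ?_
        rw [Finset.sum_mul]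
        refine Finset.sum_le_sum fun j _ => ?_
        calc _ ≤ ∑ _l : Fin (m j), F₁ := Finset.sum_le_sum fun l _ =>
              h.regular.violation_le j (by omega) (h.mem k i) l
          _ = _ := by simp
    _ = _ := by
        simp only [Finset.sum_const, Finset.card_univ, Fintype.card_fin, nsmul_eq_mul,
          Finset.card_range]
        field_simp

/-- The energy bound against a static feasible comparator. -/
theorem static_energy_le {C : ℝ} (hC : 0 ≤ C)
    (henergy : ∀ {T : ℕ}, 1 ≤ T → ∀ {y : ℕ → Vec p}, P.FeasibleSeq T y →
        ∑ k ∈ Finset.range T, ∑ i, (P.f i (k + 1) (x (k + 1) i) - P.f i (k + 1) (y (k + 1))) +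
          1 / 2 * (dualExcess F₁ (q (T + 1)) * ((T : ℝ) + 1) ^ (1 - κ)) +
          ∑ k ∈ Finset.range T, ((k : ℝ) + 2) ^ κ / (4 * α₀) *
            ∑ i, ‖x (k + 2) i - ∑ j, W (k + 1) i j • x (k + 1) j‖ ^ 2 +
          F₂ * ∑ k ∈ Finset.range T, disagreement (x (k + 1)) ≤
        C * (α₀ * (T : ℝ) ^ (1 - κ) + (T : ℝ) ^ κ * (1 + pathLength T y) / α₀))
    (h : P.PowerRun G W κ R F₁ F₂ w B α₀ x q) (hs : P.StaticFeasible) {a : ℝ} (ha : 0 < a)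
    (haα : a ≤ α₀) {T : ℕ} (hT : 1 ≤ T) :
    1 / 2 * (dualExcess F₁ (q (T + 1)) * ((T : ℝ) + 1) ^ (1 - κ)) +
      ∑ k ∈ Finset.range T, ((k : ℝ) + 2) ^ κ / (4 * α₀) *
        ∑ i, ‖x (k + 2) i - ∑ j, W (k + 1) i j • x (k + 1) j‖ ^ 2 ≤
      (n * F₁ + C / a) * T + C * (α₀ * (T : ℝ) ^ (1 - κ)) := by
  obtain ⟨y, hy⟩ := hs T hT
  have hα := h.alpha_pos
  have hT1 : (1 : ℝ) ≤ T := by exact_mod_cast hT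
  have h1 := henergy hT hy
  have hp : pathLength T (fun _ => y) = 0 := by simp [pathLength]
  have hL : -(n * F₁ * T) ≤ ∑ k ∈ Finset.range T,
      ∑ i, (P.f i (k + 1) (x (k + 1) i) - P.f i (k + 1) y) := by
    have e : -(n * F₁ * T) = ∑ _k ∈ Finset.range T, ∑ _i : Fin n, -F₁ := by simp; ring
    rw [e]
    refine Finset.sum_le_sum fun k hk => Finset.sum_le_sum fun i _ => ?_
    have hyX := (hy (k + 1) (by rw [Finset.mem_range] at hk; simp; omega)).1
    exact (abs_le.mp (h.regular.bound_f i _ (by omega) _ (h.mem k i) _ hyX)).1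
  have hD : 0 ≤ F₂ * ∑ k ∈ Finset.range T, disagreement (x (k + 1)) :=
    mul_nonneg h.F₂_nonneg (Finset.sum_nonneg fun k _ => Finset.sum_nonneg fun i _ =>
      Finset.sum_nonneg fun j _ => norm_nonneg _)
  -- The lower bound a ≤ α₀ enters here, making T^κ/α₀ at most linear in T.
  have hTκ : (T : ℝ) ^ κ * (1 + pathLength T fun _ => y) / α₀ ≤ T / a := by
    rw [hp, add_zero, mul_one]
    have : (T : ℝ) ^ κ ≤ T := by
      simpa using Real.rpow_le_rpow_of_exponent_le hT1 h.kappa_lt_one.le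
    gcongr
  have h2 := mul_le_mul_of_nonneg_left hTκ hC
  have e : C * (T / a) = C / a * T := by ring
  rw [mul_add] at h1
  linarith

/-- Dividing by the weight T^(1-κ) leaves a squared excess of order (α₀+1)T^κ. The threshold F₁ is
absorbed because √(α₀+1)·t^(κ/2) ≥ 1. -/
theorem dual_le {K : ℝ} (hK : 0 ≤ K) (h : P.PowerRun G W κ R F₁ F₂ w B α₀ x q)
    (hexcess : ∀ T : ℕ, 1 ≤ T → 1 / 2 * (dualExcess F₁ (q (T + 1)) * ((T : ℝ) + 1) ^ (1 - κ)) ≤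
      K * (α₀ + 1) * T) (k : ℕ) (i : Fin n) (l : Fin (m i)) :
    q (k + 1) i l ≤ (F₁ + √(2 * K)) * (√(α₀ + 1) * ((k : ℝ) + 1) ^ (κ / 2)) := by
  have hα := h.alpha_pos
  have hF₁ := h.F₁_nonneg
  have hκ := h.kappa_pos
  have hk0 : (0 : ℝ) < (k : ℝ) + 1 := by positivity
  have hk1 : (1 : ℝ) ≤ (k : ℝ) + 1 := by linarith [Nat.cast_nonneg (α := ℝ) k]
  cases k with
  | zero => rw [h.run.init_q]; simp; positivity
  | succ k =>
    set t : ℝ := ((k + 1 : ℕ) : ℝ) with ht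
    have ht0 : 0 ≤ t := by positivity
    have h1 := hexcess (k + 1) (by omega)
    have h2 : max (q (k + 1 + 1) i l - F₁) 0 ^ 2 ≤ dualExcess F₁ (q (k + 1 + 1)) := by
      rw [dualExcess]
      refine le_trans ?_ (Finset.single_le_sum
        (f := fun i => ∑ l, max (q (k + 1 + 1) i l - F₁) 0 ^ 2)
        (fun _ _ => Finset.sum_nonneg fun _ _ => sq_nonneg _) (Finset.mem_univ i))
      exact Finset.single_le_sum (f := fun l => max (q (k + 1 + 1) i l - F₁) 0 ^ 2)
        (fun _ _ => sq_nonneg _) (Finset.mem_univ l)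
    have h3 : max (q (k + 1 + 1) i l - F₁) 0 ^ 2 ≤ 2 * K * ((α₀ + 1) * (t + 1) ^ κ) := by
      have hp : 0 < (t + 1) ^ (1 - κ) := by positivity
      refine le_of_mul_le_mul_right ?_ hp
      have e : 2 * K * ((α₀ + 1) * (t + 1) ^ κ) * (t + 1) ^ (1 - κ) =
          2 * (K * (α₀ + 1) * (t + 1)) := by
        rw [mul_assoc, mul_assoc (α₀ + 1), ← Real.rpow_add hk0, add_sub_cancel, Real.rpow_one]
        ring
      rw [e]
      have h4 := mul_le_mul_of_nonneg_right h2 hp.le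
      have h5 : 0 ≤ K * (α₀ + 1) := by positivity
      linarith
    have h4 : max (q (k + 1 + 1) i l - F₁) 0 ≤ √(2 * K) * (√(α₀ + 1) * (t + 1) ^ (κ / 2)) := by
      refine (Real.le_sqrt_of_sq_le h3).trans (le_of_eq ?_)
      rw [Real.sqrt_mul (by positivity), Real.sqrt_mul (by positivity) ((t + 1) ^ κ),
        Real.sqrt_eq_rpow ((t + 1) ^ κ), ← Real.rpow_mul hk0.le]
      ring_nf
    have h5 : 1 ≤ √(α₀ + 1) * (t + 1) ^ (κ / 2) := by
      have h6 : 1 ≤ √(α₀ + 1) := Real.one_le_sqrt.mpr (by linarith)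
      have h7 : 1 ≤ (t + 1) ^ (κ / 2) := Real.one_le_rpow hk1 (by positivity)
      nlinarith
    have h6 := le_max_left (q (k + 1 + 1) i l - F₁) 0
    have h7 := mul_le_mul_of_nonneg_left h5 hF₁
    rw [add_mul]
    linarith

end OnlineProblem.PowerRun

/-! ### The rate of the constraint violation -/

namespace OnlineProblem.PowerRun

variable {n p : ℕ} {m : Fin n → ℕ} {P : OnlineProblem n p m} {G : ℕ → Digraph (Fin n)}
  {W : ℕ → Matrix (Fin n) (Fin n) ℝ} {κ R F₁ F₂ w : ℝ} {B : ℕ} {α₀ : ℝ}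
  {x : ℕ → Fin n → Vec p} {q : ℕ → (i : Fin n) → Vec (m i)}

/-- The cumulative local violation, from a growth bound on the dual variables. -/
theorem sum_violation_le {K : ℝ} (hK : 0 ≤ K) (h : P.PowerRun G W κ R F₁ F₂ w B α₀ x q)
    (hq : ∀ k i l, q (k + 1) i l ≤ K * (√(α₀ + 1) * ((k : ℝ) + 1) ^ (κ / 2))) {T : ℕ}
    (hT : 1 ≤ T) (i : Fin n) (l : Fin (m i)) :
    ∑ k ∈ Finset.range T, P.violation i (k + 1) (x (k + 1) i) l ≤
      4 * K * (√(α₀ + 1) * (T : ℝ) ^ (1 - κ / 2)) + ∑ k ∈ Finset.range T,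
        |P.slope i (k + 1) (x (k + 1) i) (x (k + 2) i - x (k + 1) i) l| := by
  have hκ := h.kappa_pos
  have hκ₁ := h.kappa_lt_one
  have hT1 : (1 : ℝ) ≤ T := by exact_mod_cast hT
  have hT0 : (0 : ℝ) < (T : ℝ) + 1 := by positivity
  refine ((h.dualRecursion i l).sum_le T).trans (add_le_add_left ?_ _)
  have h1 : ((T : ℝ) + 1) ^ (1 - κ) * q (T + 1) i l ≤
      K * √(α₀ + 1) * (2 * (T : ℝ) ^ (1 - κ / 2)) := by
    calc _ ≤ ((T : ℝ) + 1) ^ (1 - κ) * (K * (√(α₀ + 1) * ((T : ℝ) + 1) ^ (κ / 2))) := by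
          gcongr; exact hq T i l
      _ = K * √(α₀ + 1) * (((T : ℝ) + 1) ^ (1 - κ) * ((T : ℝ) + 1) ^ (κ / 2)) := by ring
      _ = K * √(α₀ + 1) * ((T : ℝ) + 1) ^ (1 - κ / 2) := by
          rw [← Real.rpow_add hT0]; congr 2; ring
      _ ≤ _ := by
          gcongr
          exact rpow_succ_le_two_mul (by linarith) (by linarith) hT1
  have h2 : ∑ k ∈ Finset.range T, 1 / ((k : ℝ) + 1) ^ κ * q (k + 1) i l ≤
      K * √(α₀ + 1) * (2 * (T : ℝ) ^ (1 - κ / 2)) := by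
    calc _ ≤ ∑ k ∈ Finset.range T, K * √(α₀ + 1) * (1 / ((k : ℝ) + 1) ^ (κ / 2)) := by
          refine Finset.sum_le_sum fun k _ => ?_
          have hk : (0 : ℝ) < (k : ℝ) + 1 := by positivity
          calc _ ≤ 1 / ((k : ℝ) + 1) ^ κ * (K * (√(α₀ + 1) * ((k : ℝ) + 1) ^ (κ / 2))) := by
                gcongr; exact hq k i l
            _ = _ := by
                have e : ((k : ℝ) + 1) ^ κ = ((k : ℝ) + 1) ^ (κ / 2) * ((k : ℝ) + 1) ^ (κ / 2) := by
                  rw [← Real.rpow_add hk, add_halves]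
                rw [e]
                field_simp
      _ = K * √(α₀ + 1) * ∑ k ∈ Finset.range T, 1 / ((k : ℝ) + 1) ^ (κ / 2) := by
          rw [Finset.mul_sum]
      _ ≤ K * √(α₀ + 1) * ((T : ℝ) ^ (1 - κ / 2) / (1 - κ / 2)) := by
          gcongr
          exact sum_inv_rpow_le (by linarith) (by linarith) T
      _ ≤ _ := by
          gcongr
          rw [div_le_iff₀ (by linarith)]
          have : 0 ≤ (T : ℝ) ^ (1 - κ / 2) := by positivity
          nlinarith
  linarith

/-- The cumulative perturbation, from a linear energy bound. -/
theorem sum_perturbation_le {K : ℝ} (h : P.PowerRun G W κ R F₁ F₂ w B α₀ x q) {T : ℕ}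
    (hT : 1 ≤ T) (hE : ∑ k ∈ Finset.range T, ((k : ℝ) + 2) ^ κ / (4 * α₀) *
      ∑ i, ‖x (k + 2) i - ∑ j, W (k + 1) i j • x (k + 1) j‖ ^ 2 ≤ K * T) (hK : 0 ≤ K) :
    ∑ k ∈ Finset.range T, perturbation (W (k + 1)) (x (k + 1)) (x (k + 2)) ≤
      (n / (1 - κ) + K) * (√(α₀ + 1) * (T : ℝ) ^ (1 - κ / 2)) := by
  have hα := h.alpha_pos
  have hκ₁ : 0 < 1 - κ := by linarith [h.kappa_lt_one]
  have hT0 : (0 : ℝ) < T := by exact_mod_cast hT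
  -- This c balances Young's inequality: c²α₀T^(1-κ) = T, so both parts are linear in T.
  set c : ℝ := (T : ℝ) ^ (κ / 2) / √α₀ with hc
  have hs : 0 < √α₀ := Real.sqrt_pos.mpr hα
  have hc0 : 0 < c := by positivity
  have hc2 : c ^ 2 * (α₀ * (T : ℝ) ^ (1 - κ)) = T := by
    rw [hc, div_pow, Real.sq_sqrt hα.le, ← Real.rpow_natCast, ← Real.rpow_mul hT0.le]
    rw [div_mul_eq_mul_div, mul_left_comm, mul_div_cancel_left₀ _ hα.ne', ← Real.rpow_add hT0]
    norm_num
  have hcQ : (T : ℝ) ≤ c * (√(α₀ + 1) * (T : ℝ) ^ (1 - κ / 2)) := by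
    have e : c * (√(α₀ + 1) * (T : ℝ) ^ (1 - κ / 2)) =
        √(α₀ + 1) / √α₀ * ((T : ℝ) ^ (κ / 2) * (T : ℝ) ^ (1 - κ / 2)) := by rw [hc]; ring
    rw [e, ← Real.rpow_add hT0, add_sub_cancel, Real.rpow_one]
    refine le_mul_of_one_le_left hT0.le ?_
    rw [one_le_div hs]
    exact Real.sqrt_le_sqrt (by linarith)
  have hyoung := Finset.sum_le_sum fun k (_ : k ∈ Finset.range T) => h.mul_perturbation_le c k
  simp only [Finset.sum_add_distrib] at hyoung
  rw [← Finset.mul_sum, ← Finset.mul_sum, ← Finset.mul_sum] at hyoung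
  have hpow := sum_inv_rpow_le h.kappa_pos h.kappa_lt_one T
  have h1 : n * c ^ 2 * (α₀ * ∑ k ∈ Finset.range T, 1 / ((k : ℝ) + 1) ^ κ) ≤
      n / (1 - κ) * T := by
    calc _ ≤ n * c ^ 2 * (α₀ * ((T : ℝ) ^ (1 - κ) / (1 - κ))) := by gcongr
      _ = n / (1 - κ) * (c ^ 2 * (α₀ * (T : ℝ) ^ (1 - κ))) := by ring
      _ = _ := by rw [hc2]
  refine le_of_mul_le_mul_left ?_ hc0
  have h2 : 0 ≤ n / (1 - κ) + K := by positivity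
  have h3 := mul_le_mul_of_nonneg_left hcQ h2
  calc _ ≤ (n / (1 - κ) + K) * T := by linarith
    _ ≤ _ := h3
    _ = _ := by ring

theorem sqrt_rate_eq (h : P.PowerRun G W κ R F₁ F₂ w B α₀ x q) (T : ℕ) :
    √((α₀ + 1) * (T : ℝ) ^ (2 - κ)) = √(α₀ + 1) * (T : ℝ) ^ (1 - κ / 2) := by
  have hα := h.alpha_pos
  rw [Real.sqrt_mul (by positivity), Real.sqrt_eq_rpow ((T : ℝ) ^ (2 - κ)),
    ← Real.rpow_mul (Nat.cast_nonneg T)]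
  ring_nf

/-- The constraint violation bound. -/
theorem netViolation_bound (n : ℕ) (m : Fin n → ℕ) (κ R F₁ F₂ w : ℝ) (B : ℕ) :
    ∃ C₂ : ℝ → ℝ, ∀ {p : ℕ} {P : OnlineProblem n p m} {G : ℕ → Digraph (Fin n)}
      {W : ℕ → Matrix (Fin n) (Fin n) ℝ} {α₀ : ℝ} {x : ℕ → Fin n → Vec p}
      {q : ℕ → (i : Fin n) → Vec (m i)}, P.PowerRun G W κ R F₁ F₂ w B α₀ x q →
      P.StaticFeasible → ∀ {T : ℕ}, 1 ≤ T → ∀ {a : ℝ}, 0 < a → a ≤ α₀ →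
        P.netViolation T x ≤ C₂ a * √((α₀ + 1) * (T : ℝ) ^ (2 - κ)) := by
  obtain ⟨C, hC, henergy⟩ := energy_le n m κ R F₁ F₂ w B
  let K : ℝ → ℝ := fun a => n * F₁ + C / a + C
  let A : ℝ := n ^ 2 / w ^ (n * B)
  let M : ℝ := ∑ i, (m i : ℝ)
  let L : ℝ → ℝ := fun a => n / (1 - κ) + K a
  let D : ℝ → ℝ := fun a => A * (n * B * (2 * R) + 2 * (n * B) * L a)
  refine ⟨fun a => M * (4 * (F₁ + √(2 * K a))) + M * F₂ * (L a + D a) + M * F₂ * D a + M * F₁, ?_⟩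
  intro p P G W α₀ x q h hs T hT a ha haα
  rw [h.sqrt_rate_eq]
  set Q : ℝ := √(α₀ + 1) * (T : ℝ) ^ (1 - κ / 2) with hQ
  have hα := h.alpha_pos
  have hκ := h.kappa_pos
  have hκ₁ : 0 < 1 - κ := by linarith [h.kappa_lt_one]
  have hF₁ := h.F₁_nonneg
  have hF₂ := h.F₂_nonneg
  have hR := h.R_nonneg
  have hw := h.network.w_pos
  have hT0 : (0 : ℝ) < T := by exact_mod_cast hT
  have hT1 : (1 : ℝ) ≤ T := by exact_mod_cast hT
  have hM : 0 ≤ M := Finset.sum_nonneg fun _ _ => by positivity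
  have hK : 0 ≤ K a := by positivity
  have hA : 0 ≤ A := by positivity
  have hL : 0 ≤ L a := by positivity
  have hD : 0 ≤ D a := by positivity
  have hQ1 : 1 ≤ Q := by
    have h6 : 1 ≤ √(α₀ + 1) := Real.one_le_sqrt.mpr (by linarith)
    have h7 : 1 ≤ (T : ℝ) ^ (1 - κ / 2) := Real.one_le_rpow hT1 (by linarith)
    nlinarith
  have hMF₁ : 0 ≤ M * F₁ * Q := by positivity
  simp only [add_mul]
  have hstatic := fun (T : ℕ) (hT : 1 ≤ T) => static_energy_le hC (henergy h) h hs ha haα hT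
  have hE0 : ∀ T : ℕ, 0 ≤ ∑ k ∈ Finset.range T, ((k : ℝ) + 2) ^ κ / (4 * α₀) *
        ∑ i, ‖x (k + 2) i - ∑ j, W (k + 1) i j • x (k + 1) j‖ ^ 2 := fun T =>
    Finset.sum_nonneg fun k _ => mul_nonneg (by positivity)
      (Finset.sum_nonneg fun i _ => by positivity)
  -- For α₀ ≥ T^κ, T itself is within the claimed rate. Otherwise α₀T^(1-κ) ≤ T, and the energy is
  -- linear in T with no factor α₀.
  rcases le_total ((T : ℝ) ^ κ) α₀ with hcase | hcase
  · have h1 := h.netViolation_le_mul T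
    have hTQ : (T : ℝ) ≤ Q := by
      have h2 : (T : ℝ) ^ (κ / 2) ≤ √(α₀ + 1) := by
        refine Real.le_sqrt_of_sq_le ?_
        rw [← Real.rpow_natCast, ← Real.rpow_mul hT0.le]
        norm_num
        linarith
      calc (T : ℝ) = (T : ℝ) ^ (κ / 2) * (T : ℝ) ^ (1 - κ / 2) := by
            rw [← Real.rpow_add hT0, add_sub_cancel, Real.rpow_one]
        _ ≤ Q := by rw [hQ]; gcongr
    have h3 := mul_le_mul_of_nonneg_left hTQ (by positivity : 0 ≤ M * F₁)
    have h4 : 0 ≤ M * (4 * (F₁ + √(2 * K a))) * Q := by positivity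
    have h5 : 0 ≤ M * F₂ * (L a + D a) * Q := by positivity
    have h6 : 0 ≤ M * F₂ * D a * Q := by positivity
    linarith
  -- The dual bound is needed at every intermediate horizon, where the case assumption on α₀ may
  -- fail; hence the factor α₀ + 1.
  · have hq := h.dual_le hK fun T hT => by
      have h1 := hstatic T hT
      have hT1 : (1 : ℝ) ≤ T := by exact_mod_cast hT
      have h2 : (T : ℝ) ^ (1 - κ) ≤ T := by
        simpa using Real.rpow_le_rpow_of_exponent_le hT1 (by linarith : 1 - κ ≤ 1)
      have h3 : C * (α₀ * (T : ℝ) ^ (1 - κ)) ≤ C * (α₀ * T) := by gcongr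
      have h4 : 0 ≤ (n * F₁ + C / a) * α₀ * T := by positivity
      have h5 : 0 ≤ C * T := by positivity
      have h6 := hE0 T
      have e : K a * (α₀ + 1) * T = (n * F₁ + C / a) * T + C * (α₀ * T) +
        (n * F₁ + C / a) * α₀ * T + C * T := by simp only [K]; ring
      linarith
    have hE : ∑ k ∈ Finset.range T, ((k : ℝ) + 2) ^ κ / (4 * α₀) *
        ∑ i, ‖x (k + 2) i - ∑ j, W (k + 1) i j • x (k + 1) j‖ ^ 2 ≤ K a * T := by
      have h1 := hstatic T hT
      have h2 : α₀ * (T : ℝ) ^ (1 - κ) ≤ T := by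
        calc α₀ * (T : ℝ) ^ (1 - κ) ≤ (T : ℝ) ^ κ * (T : ℝ) ^ (1 - κ) := by gcongr
          _ = T := by rw [← Real.rpow_add hT0, add_sub_cancel, Real.rpow_one]
      have h3 := mul_le_mul_of_nonneg_left h2 hC
      have h4 : 0 ≤ dualExcess F₁ (q (T + 1)) * ((T : ℝ) + 1) ^ (1 - κ) :=
        mul_nonneg (Finset.sum_nonneg fun _ _ => Finset.sum_nonneg fun _ _ => sq_nonneg _)
          (by positivity)
      have e : K a * T = (n * F₁ + C / a) * T + C * T := by simp only [K]; ring
      linarith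
    have hSP := h.sum_perturbation_le hT hE hK
    have hSD := sum_disagreement_le h.card_pos h.network x (fun k i => h.norm_le (h.mem k i)) T
    have hmove := Finset.sum_le_sum fun k (_ : k ∈ Finset.range T) => h.sum_norm_move_le k
    rw [Finset.sum_add_distrib] at hmove
    have hslope := Finset.sum_le_sum fun k (_ : k ∈ Finset.range T) => h.sum_abs_slope_le k
    rw [← Finset.mul_sum] at hslope
    have hnet := h.netViolation_le T
    have hviol : ∑ k ∈ Finset.range T, ∑ j, ∑ l, P.violation j (k + 1) (x (k + 1) j) l ≤
        M * (4 * (F₁ + √(2 * K a))) * Q + ∑ k ∈ Finset.range T, ∑ j, ∑ l,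
          |P.slope j (k + 1) (x (k + 1) j) (x (k + 2) j - x (k + 1) j) l| := by
      have hswap : ∀ F : ℕ → (j : Fin n) → Fin (m j) → ℝ,
          ∑ k ∈ Finset.range T, ∑ j, ∑ l, F k j l = ∑ j, ∑ l, ∑ k ∈ Finset.range T, F k j l := by
        intro F
        rw [Finset.sum_comm]
        exact Finset.sum_congr rfl fun j _ => Finset.sum_comm
      rw [hswap, hswap]
      have h1 := Finset.sum_le_sum fun j (_ : j ∈ Finset.univ) =>
        Finset.sum_le_sum fun l (_ : l ∈ Finset.univ) =>
          h.sum_violation_le (by positivity) hq hT j l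
      simp only [Finset.sum_add_distrib] at h1
      refine h1.trans (le_of_eq ?_)
      congr 1
      simp only [Finset.sum_const, Finset.card_univ, Fintype.card_fin, nsmul_eq_mul,
        ← Finset.sum_mul]
      ring
    set SP := ∑ k ∈ Finset.range T, perturbation (W (k + 1)) (x (k + 1)) (x (k + 2))
    set SD := ∑ k ∈ Finset.range T, disagreement (x (k + 1))
    set SM := ∑ k ∈ Finset.range T, ∑ i, ‖x (k + 2) i - x (k + 1) i‖
    have hSD' : SD ≤ D a * Q := by
      calc SD ≤ A * (n * B * (2 * R) + 2 * (n * B) * SP) := hSD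
        _ ≤ A * (n * B * (2 * R) * Q + 2 * (n * B) * (L a * Q)) := by
            refine mul_le_mul_of_nonneg_left (add_le_add ?_ ?_) hA
            · exact le_mul_of_one_le_right (by positivity) hQ1
            · exact mul_le_mul_of_nonneg_left hSP (by positivity)
        _ = D a * Q := by simp only [D]; ring
    have hSM : M * F₂ * SM ≤ M * F₂ * (L a + D a) * Q := by
      rw [mul_assoc _ (L a + D a)]
      refine mul_le_mul_of_nonneg_left ?_ (by positivity)
      have : SP ≤ L a * Q := hSP
      linarith
    have hSD'' : M * F₂ * SD ≤ M * F₂ * D a * Q := by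
      rw [mul_assoc _ (D a)]
      gcongr
    have hslope' := hslope.trans hSM
    have hnet' : P.netViolation T x ≤ ∑ k ∈ Finset.range T, ∑ j, ∑ l,
      P.violation j (k + 1) (x (k + 1) j) l + M * F₂ * SD := hnet
    linarith

end OnlineProblem.PowerRun

/-! ### Assembly -/

theorem mainTheorem1 (n : ℕ) (hn : 0 < n) (m : Fin n → ℕ) (κ : ℝ) (hκ₀ : 0 < κ) (hκ₁ : κ < 1)
    (R F₁ F₂ w : ℝ) (B : ℕ) :
    ∃ (C₁ : ℝ) (C₂ : ℝ → ℝ),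
      ∀ (p : ℕ) (P : OnlineProblem n p m) (G : ℕ → Digraph (Fin n))
        (W : ℕ → Matrix (Fin n) (Fin n) ℝ),
        P.Regular R F₁ F₂ → P.StaticFeasible → MixingNetwork G W w B →
      ∀ (α₀ : ℝ), 0 < α₀ →
      ∀ (x : ℕ → Fin n → Vec p) (q : ℕ → (i : Fin n) → Vec (m i)),
        P.IsRun W (fun t => α₀ / (t : ℝ) ^ κ) (fun t => 1 / (t : ℝ) ^ κ)
          (fun t => 1 / (t : ℝ) ^ (1 - κ)) x q →
      ∀ T : ℕ, 1 ≤ T →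
        (∀ y : ℕ → Vec p, P.FeasibleSeq T y →
          P.netReg T x y ≤
            C₁ * (α₀ * (T : ℝ) ^ (1 - κ) + (T : ℝ) ^ κ * (1 + pathLength T y) / α₀)) ∧
        (∀ a : ℝ, 0 < a → a ≤ α₀ →
          P.netViolation T x ≤ C₂ a * √((α₀ + 1) * (T : ℝ) ^ (2 - κ))) := by
  obtain ⟨C₁, hC₁, henergy⟩ := OnlineProblem.PowerRun.energy_le n m κ R F₁ F₂ w B
  obtain ⟨C₂, hC₂⟩ := OnlineProblem.PowerRun.netViolation_bound n m κ R F₁ F₂ w B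
  refine ⟨C₁, C₂, fun p P G W hP hs hW α₀ hα x q hrun T hT => ?_⟩
  have h : P.PowerRun G W κ R F₁ F₂ w B α₀ x q := ⟨hn, hκ₀, hκ₁, hP, hW, hα, hrun⟩
  refine ⟨fun y hy => ?_, fun a ha haα => hC₂ h hs hT ha haα⟩
  have h1 := henergy h hT hy
  have h2 := h.card_mul_netReg_le T (y := y)
  have h3 : 0 ≤ dualExcess F₁ (q (T + 1)) * ((T : ℝ) + 1) ^ (1 - κ) :=
    mul_nonneg (Finset.sum_nonneg fun _ _ => Finset.sum_nonneg fun _ _ => sq_nonneg _)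
      (by positivity)
  have h4 : 0 ≤ ∑ k ∈ Finset.range T, ((k : ℝ) + 2) ^ κ / (4 * α₀) *
      ∑ i, ‖x (k + 2) i - ∑ j, W (k + 1) i j • x (k + 1) j‖ ^ 2 :=
    Finset.sum_nonneg fun k _ => mul_nonneg (by positivity)
      (Finset.sum_nonneg fun i _ => by positivity)
  have hp : 0 ≤ pathLength T y := Finset.sum_nonneg fun _ _ => norm_nonneg _
  have h5 : 0 ≤ C₁ * (α₀ * (T : ℝ) ^ (1 - κ) + (T : ℝ) ^ κ * (1 + pathLength T y) / α₀) := by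
    positivity
  have hn1 : (1 : ℝ) ≤ n := by exact_mod_cast hn
  -- The available bound is for n times the regret; passing to the regret itself needs it
  -- nonnegative, and otherwise the right side is.
  rcases le_total (P.netReg T x y) 0 with h6 | h6
  · exact h6.trans h5
  · have h7 := le_mul_of_one_le_left h6 hn1
    linarith
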